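/- **Theorem.** *Notation.* A Lévy measure on $\mathbb R^d$ is a Borel measure $\nu$ with $\nu(\{0\})=0$ and $\int(1\wedge|x|^2)\,\nu(dx)<\infty$; $\mathfrak M_L^1(\mathbb R^d)$ is the class of those with $\int(1\wedge|x|)\,\nu(dx)<\infty$. A polar decomposition of $\nu$ is a pair $(\lambda,(\nu_\xi))$, where $\lambda$ is a measure on the unit sphere $\mathbb S$ of $\mathbb R^d$ and $(\nu_\xi)_{\xi\in\mathbb S}$ is a measurable family of nonzero measures on $(0,\infty)$, such that $\nu(B)=\int_{\mathbb S}\lambda(d\xi)\int_0^\infty 1_B(r\xi)\,\nu_\xi(dr)$ for all Borel sets $B$; for a Lévy measure, $\nu_\xi$ (the radial component) is unique up to positive factors depending on $\xi$, for $\lambda$-a.e. $\xi$. A function $g$ on $(0,\infty)$ is completely monotone if it is $C^\infty$ and $(-1)^n g^{(n)}\ge 0$ for all $n\ge 0$. The class $\mathfrak M_L^B(\mathbb R^d)$ of Lévy measures of the Goldie–Steutel–Bondesson class consists of the Lévy measures having a polar decomposition such that, for $\lambda$-a.e. $\xi$, $\nu_\xi(dr)=h_\xi(r)\,dr$ with $h_\xi$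 completely monotone. The class $G(\mathbb R^d)$ of generalized type $G$ distributions consists of the infinitely divisible distributions whose Lévy measure has a polar decomposition such that, for $\lambda$-a.e. $\xi$, $\nu_\xi(dr)=g_\xi(r^2)\,dr$ with $g_\xi$ completely monotone. Let $a_1(r;s)=\frac2\pi(s-r^2)^{-1/2}$ for $0<r<s^{1/2}$ and $a_1(r;s)=0$ otherwise, and set, for Borel sets $B\subset\mathbb R^d$, $$\mathcal A_1(\nu)(B)=\int_{\mathbb R^d\setminus\{0\}}\nu(dx)\int_0^\infty a_1(r;|x|)\,1_B\!\left(r\tfrac{x}{|x|}\right)dr,\qquad \Upsilon^0(\nu)(B)=\int_0^\infty \nu(u^{-1}B)\,e^{-u}\,du .$$ *Statement.* Let $\widetilde\mu$ be an infinitely divisible distribution on $\mathbb R^d$ with Lévy–Khintchine triplet $(\widetilde\Sigma,\widetilde\nu,\widetilde\gamma)$, that is, $\widetilde\Sigma$ is symmetric nonnegative-definite, $\widetilde\nu$ is a Lévy measure, $\widetilde\gamma\in\mathbb R^d$, and for all $z\in\mathbb R^d$ $$\int e^{i\langle x,z\rangle}\widetilde\mu(dx)=\exp\Big\{-\tfrac12\langle\widetilde\Sigma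 z,z\rangle+i\langle\widetilde\gamma,z\rangle+\int_{\mathbb R^d}\Big(e^{i\langle x,z\rangle}-1-\tfrac{i\langle x,z\rangle}{1+|x|^2}\Big)\widetilde\nu(dx)\Big\}.$$ Then the following three conditions are equivalent: (a) $\widetilde\mu\in G(\mathbb R^d)$; (b) $\widetilde\nu=\mathcal A_1(\nu)$ for some $\nu\in\mathfrak M_L^B(\mathbb R^d)\cap\mathfrak M_L^1(\mathbb R^d)$; (c) $\widetilde\nu=\mathcal A_1(\Upsilon^0(\rho))$ for some $\rho\in\mathfrak M_L^1(\mathbb R^d)$. Moreover, there is at most one $\nu$ as in (b) and at most one $\rho$ as in (c). -/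

import Mathlib

open MeasureTheory ProbabilityTheory Set Metric
open scoped ENNReal ContDiff

noncomputable section

namespace ArcsineTransform

/-- A probability law `μ` on `ℝ^d` is infinitely divisible if for every `n ≥ 1` it is the law of a
sum of `n` independent random vectors with a common distribution `η`. -/
def IsInfinitelyDivisible {d : ℕ} (μ : Measure (EuclideanSpace ℝ (Fin d))) : Prop :=
  IsProbabilityMeasure μ ∧
    ∀ n : ℕ, 1 ≤ n → ∃ η : Measure (EuclideanSpace ℝ (Fin d)), IsProbabilityMeasure η ∧
      μ = (Measure.pi (fun _ : Fin n => η)).map (fun x => ∑ i, x i)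

/-- Lévy measures on `ℝ^d`: `ν({0}) = 0` and `∫ (1 ∧ |x|²) ν(dx) < ∞`. -/
structure IsLevyMeasure {d : ℕ} (ν : Measure (EuclideanSpace ℝ (Fin d))) : Prop where
  zero : ν {0} = 0
  lintegral_lt_top : ∫⁻ x, ENNReal.ofReal (min 1 (‖x‖ ^ 2)) ∂ν < ⊤

/-- Lévy measures on `ℝ^d` with `∫ (1 ∧ |x|) ν(dx) < ∞`. -/
structure IsLevyMeasureOne {d : ℕ} (ν : Measure (EuclideanSpace ℝ (Fin d))) : Prop where
  isLevyMeasure : IsLevyMeasure ν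
  lintegral_lt_top : ∫⁻ x, ENNReal.ofReal (min 1 ‖x‖) ∂ν < ⊤

/-- The law `μ` on `ℝ^d` has Lévy-Khintchine triplet `(S, ν, γ)`. -/
structure HasLevyKhintchineTriplet {d : ℕ} (μ : Measure (EuclideanSpace ℝ (Fin d)))
    (S : Matrix (Fin d) (Fin d) ℝ) (ν : Measure (EuclideanSpace ℝ (Fin d)))
    (γ : EuclideanSpace ℝ (Fin d)) : Prop where
  posSemidef : S.PosSemidef
  isLevyMeasure : IsLevyMeasure ν
  charFun_eq : ∀ z : EuclideanSpace ℝ (Fin d),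
    charFun μ z = Complex.exp
      (-(1 / 2) * (inner ℝ (S.toEuclideanLin z) z : ℝ) + Complex.I * (inner ℝ γ z : ℝ)
        + ∫ x, (Complex.exp (Complex.I * (inner ℝ x z : ℝ)) - 1
            - Complex.I * (inner ℝ x z : ℝ) / ((1 + ‖x‖ ^ 2 : ℝ) : ℂ)) ∂ν)

/-- `g` is completely monotone on `(0, ∞)`. -/
def IsCompletelyMonotone (g : ℝ → ℝ) : Prop :=
  ContDiffOn ℝ ∞ g (Ioi 0) ∧ ∀ n : ℕ, ∀ u : ℝ, 0 < u → 0 ≤ (-1) ^ n * iteratedDeriv n g u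

/-- `(σ, κ)` is a polar decomposition of `ν`: `σ` is a measure on the unit sphere, `κ ξ` is a
measure on `(0, ∞)` (the radial component in direction `ξ`), nonzero and measurable in `ξ`, and
`ν(B) = ∫ σ(dξ) ∫ 1_B(r ξ) κ_ξ(dr)`. -/
structure IsPolarDecomposition {d : ℕ} (ν : Measure (EuclideanSpace ℝ (Fin d)))
    (σ : Measure (sphere (0 : EuclideanSpace ℝ (Fin d)) 1))
    (κ : Kernel (sphere (0 : EuclideanSpace ℝ (Fin d)) 1) ℝ) : Prop where
  concentrated : ∀ ξ, κ ξ (Iic 0) = 0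
  pos : ∀ ξ, 0 < κ ξ (Ioi 0)
  apply_eq : ∀ B : Set (EuclideanSpace ℝ (Fin d)), MeasurableSet B →
    ν B = ∫⁻ ξ, (∫⁻ r in Ioi 0,
      B.indicator (fun _ => (1 : ℝ≥0∞)) (r • (ξ : EuclideanSpace ℝ (Fin d))) ∂(κ ξ)) ∂σ

/-- The Lévy measures of the Goldie-Steutel-Bondesson class: the radial component is
`h_ξ(r) dr` with `h_ξ` completely monotone on `(0, ∞)`. The radial component is determined by the
Lévy measure up to positive factors and up to a null set of directions. -/
def IsLevyMeasureB {d : ℕ} (ν : Measure (EuclideanSpace ℝ (Fin d))) : Prop :=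
  IsLevyMeasure ν ∧ ∃ σ κ, IsPolarDecomposition ν σ κ ∧
    ∀ᵐ ξ ∂σ, ∃ h : ℝ → ℝ, IsCompletelyMonotone h ∧
      κ ξ = (volume.restrict (Ioi 0)).withDensity (fun r => ENNReal.ofReal (h r))

/-- The Lévy measures of generalized type `G` laws: the radial component is
`g_ξ(r²) dr` with `g_ξ` completely monotone on `(0, ∞)`. -/
def IsLevyMeasureG {d : ℕ} (ν : Measure (EuclideanSpace ℝ (Fin d))) : Prop :=
  IsLevyMeasure ν ∧ ∃ σ κ, IsPolarDecomposition ν σ κ ∧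
    ∀ᵐ ξ ∂σ, ∃ g : ℝ → ℝ, IsCompletelyMonotone g ∧
      κ ξ = (volume.restrict (Ioi 0)).withDensity (fun r => ENNReal.ofReal (g (r ^ 2)))

/-- The class `G(ℝ^d)` of generalized type `G` distributions. -/
def classG (d : ℕ) : Set (Measure (EuclideanSpace ℝ (Fin d))) :=
  {μ | IsInfinitelyDivisible μ ∧ ∃ S ν γ, HasLevyKhintchineTriplet μ S ν γ ∧ IsLevyMeasureG ν}

/-- The one-sided arcsine density `a₁(r; s)`. -/
def arcsineDensity (r s : ℝ) : ℝ :=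
  if 0 < r ∧ r < √s then 2 / Real.pi * (s - r ^ 2) ^ (-(1 / 2) : ℝ) else 0

/-- The image of the arcsine law `a₁(r; |x|) dr` under `r ↦ r x / |x|`. -/
def arcsineRay {d : ℕ} (x : EuclideanSpace ℝ (Fin d)) : Measure (EuclideanSpace ℝ (Fin d)) :=
  ((volume.restrict (Ioi 0)).withDensity
    (fun r => ENNReal.ofReal (arcsineDensity r ‖x‖))).map (fun r : ℝ => r • (‖x‖⁻¹ • x))

/-- The arcsine transformation `𝒜₁` of measures on `ℝ^d`; see `arcsine_apply` for its values. -/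
def arcsine {d : ℕ} (ν : Measure (EuclideanSpace ℝ (Fin d))) :
    Measure (EuclideanSpace ℝ (Fin d)) :=
  (ν.restrict {0}ᶜ).bind arcsineRay

/-- The transformation `Υ⁰` of measures on `ℝ^d`; see `upsilonZero_apply` for its values. -/
def upsilonZero {d : ℕ} (ν : Measure (EuclideanSpace ℝ (Fin d))) :
    Measure (EuclideanSpace ℝ (Fin d)) :=
  (((volume.restrict (Ioi 0)).withDensity
    (fun u : ℝ => ENNReal.ofReal (Real.exp (-u)))).prod ν).map (fun p => p.1 • p.2)

theorem measurable_arcsineDensity :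
    Measurable (fun p : ℝ × ℝ => arcsineDensity p.1 p.2) := by
  unfold arcsineDensity
  refine Measurable.ite ?_ (by fun_prop) measurable_const
  exact (measurableSet_lt measurable_const measurable_fst).inter
    (measurableSet_lt measurable_fst (by fun_prop))

theorem arcsineRay_apply {d : ℕ} (x : EuclideanSpace ℝ (Fin d))
    {B : Set (EuclideanSpace ℝ (Fin d))} (hB : MeasurableSet B) :
    arcsineRay x B = ∫⁻ r in Ioi (0 : ℝ), ENNReal.ofReal (arcsineDensity r ‖x‖) *
      B.indicator (fun _ => (1 : ℝ≥0∞)) (r • (‖x‖⁻¹ • x)) := by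
  have hf : Measurable (fun r : ℝ => r • (‖x‖⁻¹ • x)) := by fun_prop
  have ha : Measurable (fun r : ℝ => ENNReal.ofReal (arcsineDensity r ‖x‖)) :=
    (measurable_arcsineDensity.comp (by fun_prop : Measurable fun r : ℝ => (r, ‖x‖))).ennreal_ofReal
  rw [arcsineRay, Measure.map_apply hf hB, withDensity_apply _ (hf hB),
    ← lintegral_indicator (hf hB)]
  refine lintegral_congr fun r => ?_
  by_cases h : r • (‖x‖⁻¹ • x) ∈ B
  · rw [indicator_of_mem (show r ∈ (fun r : ℝ => r • (‖x‖⁻¹ • x)) ⁻¹' B from h),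
      indicator_of_mem h, mul_one]
  · rw [indicator_of_notMem (show r ∉ (fun r : ℝ => r • (‖x‖⁻¹ • x)) ⁻¹' B from h),
      indicator_of_notMem h, mul_zero]

theorem measurable_arcsineRay {d : ℕ} :
    Measurable (arcsineRay : EuclideanSpace ℝ (Fin d) → _) := by
  refine Measure.measurable_of_measurable_coe _ fun B hB => ?_
  simp_rw [arcsineRay_apply _ hB]
  refine Measurable.lintegral_prod_right'
    (f := fun p : EuclideanSpace ℝ (Fin d) × ℝ => ENNReal.ofReal (arcsineDensity p.2 ‖p.1‖) *
      B.indicator (fun _ => (1 : ℝ≥0∞)) (p.2 • (‖p.1‖⁻¹ • p.1))) ?_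
  refine Measurable.mul ?_ ?_
  · exact (measurable_arcsineDensity.comp (by fun_prop :
      Measurable fun p : EuclideanSpace ℝ (Fin d) × ℝ => (p.2, ‖p.1‖))).ennreal_ofReal
  · exact (measurable_const.indicator hB).comp (by fun_prop)

/-- `𝒜₁(ν)(B) = ∫_{x ≠ 0} ν(dx) ∫_0^∞ a₁(r; |x|) 1_B(r x / |x|) dr`. -/
theorem arcsine_apply {d : ℕ} (ν : Measure (EuclideanSpace ℝ (Fin d)))
    {B : Set (EuclideanSpace ℝ (Fin d))} (hB : MeasurableSet B) :
    arcsine ν B = ∫⁻ x in {0}ᶜ, (∫⁻ r in Ioi (0 : ℝ), ENNReal.ofReal (arcsineDensity r ‖x‖) *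
      B.indicator (fun _ => (1 : ℝ≥0∞)) (r • (‖x‖⁻¹ • x))) ∂ν := by
  rw [arcsine, Measure.bind_apply hB measurable_arcsineRay.aemeasurable]
  simp_rw [arcsineRay_apply _ hB]

/-- Lévy measures are `σ`-finite. -/
theorem IsLevyMeasure.sigmaFinite {d : ℕ} {ν : Measure (EuclideanSpace ℝ (Fin d))}
    (h : IsLevyMeasure ν) : SigmaFinite ν := by
  refine ⟨⟨⟨fun n : ℕ => {0} ∪ {x | ENNReal.ofReal ((1 / ((n : ℝ) + 1)) ^ 2) ≤
    ENNReal.ofReal (min 1 (‖x‖ ^ 2))}, fun _ => trivial, fun n => ?_, ?_⟩⟩⟩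
  · refine (measure_union_le _ _).trans_lt ?_
    rw [h.zero, zero_add]
    refine (meas_ge_le_lintegral_div (by fun_prop) ?_ ENNReal.ofReal_ne_top).trans_lt
      (ENNReal.div_lt_top h.lintegral_lt_top.ne ?_) <;>
    · rw [Ne, ENNReal.ofReal_eq_zero, not_le]
      positivity
  · refine eq_univ_of_forall fun x => mem_iUnion.2 ?_
    rcases eq_or_ne x 0 with rfl | hx
    · exact ⟨0, Or.inl rfl⟩
    · obtain ⟨n, hn⟩ := exists_nat_one_div_lt (norm_pos_iff.2 hx)
      refine ⟨n, Or.inr (ENNReal.ofReal_le_ofReal (le_min ?_ ?_))⟩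
      · refine pow_le_one₀ (by positivity) ?_
        rw [div_le_one (by positivity)]
        have : (0 : ℝ) ≤ n := n.cast_nonneg
        linarith
      · exact pow_le_pow_left₀ (by positivity) hn.le 2

/-- `Υ⁰(ν)(B) = ∫_0^∞ ν(u⁻¹ B) e^{-u} du`. -/
theorem upsilonZero_apply {d : ℕ} (ν : Measure (EuclideanSpace ℝ (Fin d))) [SFinite ν]
    {B : Set (EuclideanSpace ℝ (Fin d))} (hB : MeasurableSet B) :
    upsilonZero ν B = ∫⁻ u in Ioi (0 : ℝ),
      ν ((fun x => u • x) ⁻¹' B) * ENNReal.ofReal (Real.exp (-u)) := by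
  have hm : Measurable (fun p : ℝ × EuclideanSpace ℝ (Fin d) => p.1 • p.2) := by fun_prop
  rw [upsilonZero, Measure.map_apply hm hB, Measure.prod_apply (hm hB),
    lintegral_withDensity_eq_lintegral_mul _ (by fun_prop)
      (measurable_measure_prodMk_left (hm hB))]
  refine lintegral_congr fun u => ?_
  rw [Pi.mul_apply, mul_comm]
  rfl

end ArcsineTransform

end

noncomputable section

namespace ArcsineTransform

open Filter Topology

/-! ### Uniqueness of the Lévy measure in the Lévy-Khintchine representation -/

/-! Both transformations act separately on each ray, so the problem is radial and is governed by the
mixtures `rayTransform (expKernel p) η` of the densities `exp (-r ^ p / s)`. By Bernstein's theorem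
a completely monotone density is a Laplace mixture. Hence Lévy measures of class B are exactly the
Lévy measures that are such mixtures with `p = 1`, and those of generalized type G are the ones with
`p = 2` (`exists_eq_rayTransform_expKernel` and `exists_polarDecomposition_rayTransform`).

The decisive identity is `∫ a₁(r; t) exp (-t / s) dt = (2 / √π) √s exp (-r² / s)`. It says that `𝒜₁`
turns a mixture with `p = 1` into one with `p = 2` and multiplies the mixing measure by `(2 / √π)
√|x|` (`arcsine_rayTransform_expKernel`). This gives (b) ⇒ (a). Moreover `Υ⁰(ρ)` is the mixture with
`p = 1` and mixing measure `|x|⁻¹ ρ(dx)`, which gives (c) ⇒ (b). For (a) ⇒ (c) the resulting factor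
`(2 / √π) |x|^(-1/2)` is inverted: a mixing measure `η` for `p = 2` gives `ρ = (√π / 2) √|x| η(dx)`,
and `∫ (1 ∧ |x|) dρ < ∞` follows from the Lévy property by the lower bound
`sqrt_mul_min_one_le_expWeight`. Since (a) only asserts that some triplet has a type G Lévy measure,
uniqueness of the Lévy measure in the Lévy-Khintchine formula is also needed.

`𝒜₁` is injective because testing against Abel's kernel recovers the radial tails
(`lintegral_arcsine_abel`). `Υ⁰` is injective because the tails of `Υ⁰(ρ)` at the radii `k + 1` are
the moments of the variable `exp (-1 / |x|)` under a weighted `ρ`, and moments determine a finite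
measure on `[0, 1]`.

Bernstein's theorem is derived from the Hausdorff moment problem on `[0, 1]`. The representing
measures can be chosen measurably in the direction because their moments are limits of quantities
computed from the radial kernel. -/

theorem IsLevyMeasure.integrable {d : ℕ} {ν : Measure (EuclideanSpace ℝ (Fin d))}
    (h : IsLevyMeasure ν) : Integrable (fun x => min 1 (‖x‖ ^ 2)) ν := by
  refine ⟨by fun_prop, ?_⟩
  rw [hasFiniteIntegral_iff_ofReal (.of_forall fun x => by positivity)]
  exact h.lintegral_lt_top

/-- The integrand of the Lévy-Khintchine formula. -/
def lkIntegrand {d : ℕ} (z x : EuclideanSpace ℝ (Fin d)) : ℂ :=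
  Complex.exp (Complex.I * (inner ℝ x z : ℝ)) - 1
    - Complex.I * (inner ℝ x z : ℝ) / ((1 + ‖x‖ ^ 2 : ℝ) : ℂ)

theorem one_add_norm_sq_ne_zero {d : ℕ} (x : EuclideanSpace ℝ (Fin d)) :
    ((1 + ‖x‖ ^ 2 : ℝ) : ℂ) ≠ 0 := by
  rw [Complex.ofReal_ne_zero]; positivity

theorem continuous_lkIntegrand {d : ℕ} :
    Continuous fun p : EuclideanSpace ℝ (Fin d) × EuclideanSpace ℝ (Fin d) =>
      lkIntegrand p.1 p.2 := by
  unfold lkIntegrand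
  refine Continuous.sub (by fun_prop) (Continuous.div (by fun_prop) (by fun_prop) fun p => ?_)
  exact one_add_norm_sq_ne_zero _

theorem norm_exp_I_mul_sub_one_sub_le (t : ℝ) :
    ‖Complex.exp (Complex.I * t) - 1 - Complex.I * t‖ ≤ 3 * t ^ 2 := by
  rcases le_total |t| 1 with h | h
  · refine (Complex.norm_exp_sub_one_sub_id_le (by simpa using h)).trans ?_
    simp only [norm_mul, Complex.norm_I, one_mul, Complex.norm_real, Real.norm_eq_abs, sq_abs]
    nlinarith [sq_nonneg t]
  · have h1 : ‖Complex.exp (Complex.I * t)‖ = 1 := by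
      rw [mul_comm]; exact Complex.norm_exp_ofReal_mul_I t
    have h2 : ‖Complex.exp (Complex.I * t) - 1 - Complex.I * t‖ ≤ 1 + 1 + |t| := by
      refine (norm_sub_le _ _).trans (add_le_add ((norm_sub_le _ _).trans ?_) ?_)
      · simp [h1]
      · simp
    have h3 : t ^ 2 = |t| ^ 2 := (sq_abs t).symm
    nlinarith

/-- For `|x| ≤ 1` the compensator differs from `i⟨x, z⟩` by a term of order `|x|³`, leaving the
second-order Taylor remainder of the exponential. For `|x| ≥ 1` every term is bounded. The constant
is monotone in `‖z‖`, so the bound is locally uniform in `z`. -/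
theorem norm_lkIntegrand_le {d : ℕ} (z x : EuclideanSpace ℝ (Fin d)) :
    ‖lkIntegrand z x‖ ≤ (3 * ‖z‖ ^ 2 + ‖z‖ + 2) * min 1 (‖x‖ ^ 2) := by
  set t : ℝ := inner ℝ x z with ht
  have hxz : |t| ≤ ‖x‖ * ‖z‖ := abs_real_inner_le_norm x z
  have hz := norm_nonneg z
  have hx := norm_nonneg x
  have hp : (0 : ℝ) < 1 + ‖x‖ ^ 2 := by positivity
  rcases le_total ‖x‖ 1 with h | h
  · have hm : min 1 (‖x‖ ^ 2) = ‖x‖ ^ 2 := min_eq_right (by nlinarith)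
    have h1 : lkIntegrand z x = (Complex.exp (Complex.I * t) - 1 - Complex.I * t)
        + Complex.I * ((t * (‖x‖ ^ 2 / (1 + ‖x‖ ^ 2)) : ℝ) : ℂ) := by
      have := one_add_norm_sq_ne_zero x
      unfold lkIntegrand
      rw [← ht]
      push_cast at this ⊢
      field_simp
      ring
    have h2 : ‖x‖ ^ 2 / (1 + ‖x‖ ^ 2) ≤ ‖x‖ ^ 2 := div_le_self (by positivity) (by nlinarith)
    have h3 : ‖Complex.I * ((t * (‖x‖ ^ 2 / (1 + ‖x‖ ^ 2)) : ℝ) : ℂ)‖ ≤ ‖z‖ * ‖x‖ ^ 2 := by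
      rw [norm_mul, Complex.norm_I, one_mul, Complex.norm_real, Real.norm_eq_abs, abs_mul,
        abs_of_nonneg (by positivity : 0 ≤ ‖x‖ ^ 2 / (1 + ‖x‖ ^ 2))]
      refine mul_le_mul ?_ h2 (by positivity) hz
      nlinarith
    have h4 : t ^ 2 ≤ ‖z‖ ^ 2 * ‖x‖ ^ 2 := by
      rw [← sq_abs, ← mul_pow, mul_comm ‖z‖]
      exact pow_le_pow_left₀ (abs_nonneg _) hxz 2
    rw [h1, hm]
    refine (norm_add_le _ _).trans ((add_le_add (norm_exp_I_mul_sub_one_sub_le t) h3).trans ?_)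
    nlinarith [sq_nonneg ‖x‖]
  · have hm : min 1 (‖x‖ ^ 2) = 1 := min_eq_left (by nlinarith)
    have h1 : ‖Complex.exp (Complex.I * t)‖ = 1 := by
      rw [mul_comm]; exact Complex.norm_exp_ofReal_mul_I t
    have h2 : ‖Complex.I * (t : ℂ) / ((1 + ‖x‖ ^ 2 : ℝ) : ℂ)‖ ≤ ‖z‖ := by
      rw [norm_div, norm_mul, Complex.norm_I, one_mul, Complex.norm_real, Complex.norm_real,
        Real.norm_eq_abs, Real.norm_of_nonneg hp.le, div_le_iff₀ hp]
      have h2 : ‖x‖ ≤ 1 + ‖x‖ ^ 2 := by nlinarith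
      nlinarith [mul_le_mul_of_nonneg_right h2 hz]
    rw [hm, mul_one]
    have h3 : ‖lkIntegrand z x‖ ≤ 1 + 1 + ‖z‖ := by
      unfold lkIntegrand
      refine (norm_sub_le _ _).trans (add_le_add ((norm_sub_le _ _).trans ?_) h2)
      rw [h1, norm_one]
    nlinarith [sq_nonneg ‖z‖]

theorem IsLevyMeasure.integrable_lkIntegrand {d : ℕ} {ν : Measure (EuclideanSpace ℝ (Fin d))}
    (h : IsLevyMeasure ν) (z : EuclideanSpace ℝ (Fin d)) : Integrable (lkIntegrand z) ν :=
  (h.integrable.const_mul (3 * ‖z‖ ^ 2 + ‖z‖ + 2)).mono'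
    (continuous_lkIntegrand.comp (by fun_prop : Continuous fun x => (z, x))).aestronglyMeasurable
    (.of_forall (norm_lkIntegrand_le z))

theorem IsLevyMeasure.continuous_integral_lkIntegrand {d : ℕ}
    {ν : Measure (EuclideanSpace ℝ (Fin d))} (h : IsLevyMeasure ν) :
    Continuous fun z => ∫ x, lkIntegrand z x ∂ν := by
  refine continuous_iff_continuousAt.2 fun z₀ => ?_
  refine continuousAt_of_dominated
    (bound := fun x => (3 * (‖z₀‖ + 1) ^ 2 + (‖z₀‖ + 1) + 2) * min 1 (‖x‖ ^ 2))
    (.of_forall fun z => (h.integrable_lkIntegrand z).aestronglyMeasurable) ?_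
    (h.integrable.const_mul _)
    (.of_forall fun x => (continuous_lkIntegrand.comp
      (by fun_prop : Continuous fun z => (z, x))).continuousAt)
  have : ∀ᶠ z in 𝓝 z₀, ‖z‖ < ‖z₀‖ + 1 :=
    continuous_norm.continuousAt.eventually_lt continuousAt_const (lt_add_one _)
  filter_upwards [this] with z hz
  refine .of_forall fun x => (norm_lkIntegrand_le z x).trans ?_
  gcongr

/-- The logarithm of a characteristic function in Lévy-Khintchine form. -/
def lkExponent {d : ℕ} (S : Matrix (Fin d) (Fin d) ℝ) (ν : Measure (EuclideanSpace ℝ (Fin d)))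
    (γ z : EuclideanSpace ℝ (Fin d)) : ℂ :=
  -(1 / 2) * (inner ℝ (S.toEuclideanLin z) z : ℝ) + Complex.I * (inner ℝ γ z : ℝ)
    + ∫ x, lkIntegrand z x ∂ν

theorem continuous_lkExponent {d : ℕ} (S : Matrix (Fin d) (Fin d) ℝ)
    {ν : Measure (EuclideanSpace ℝ (Fin d))} (h : IsLevyMeasure ν)
    (γ : EuclideanSpace ℝ (Fin d)) : Continuous (lkExponent S ν γ) := by
  have h1 : Continuous fun z => S.toEuclideanLin z :=
    LinearMap.continuous_of_finiteDimensional _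
  unfold lkExponent
  exact Continuous.add (by fun_prop) h.continuous_integral_lkIntegrand

/-- The values lie in the discrete set `2πiℤ`, so the zero set is both open and closed. -/
theorem eq_zero_of_exp_eq_one {X : Type*} [TopologicalSpace X] [PreconnectedSpace X]
    {f : X → ℂ} (hf : Continuous f) (h : ∀ x, Complex.exp (f x) = 1) {x₀ : X} (h₀ : f x₀ = 0)
    (x : X) : f x = 0 := by
  have hcl : IsClopen {x | f x = 0} := by
    refine ⟨isClosed_eq hf continuous_const, isOpen_iff_mem_nhds.2 fun y hy => ?_⟩
    have : ∀ᶠ z in 𝓝 y, ‖f z‖ < 1 := by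
      refine hf.norm.continuousAt.eventually_lt continuousAt_const ?_
      rw [show f y = 0 from hy]; simp
    filter_upwards [this] with z hz
    obtain ⟨n, hn⟩ := Complex.exp_eq_one_iff.1 (h z)
    rcases eq_or_ne n 0 with rfl | hn0
    · simpa using hn
    · exfalso
      have h1 : (1 : ℝ) ≤ |(n : ℝ)| := by exact_mod_cast Int.one_le_abs hn0
      have h2 : ‖f z‖ = |(n : ℝ)| * (2 * Real.pi) := by
        rw [hn]; simp [abs_of_pos Real.pi_pos]
      nlinarith [Real.pi_gt_three]
  have := hcl.eq_univ ⟨x₀, h₀⟩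
  exact this.symm.subset (mem_univ x)

theorem lkExponent_zero {d : ℕ} (S : Matrix (Fin d) (Fin d) ℝ)
    (ν : Measure (EuclideanSpace ℝ (Fin d))) (γ : EuclideanSpace ℝ (Fin d)) :
    lkExponent S ν γ 0 = 0 := by
  simp [lkExponent, lkIntegrand]

theorem HasLevyKhintchineTriplet.lkExponent_eq {d : ℕ} {μ : Measure (EuclideanSpace ℝ (Fin d))}
    {S₁ S₂ : Matrix (Fin d) (Fin d) ℝ} {ν₁ ν₂ : Measure (EuclideanSpace ℝ (Fin d))}
    {γ₁ γ₂ : EuclideanSpace ℝ (Fin d)} (h₁ : HasLevyKhintchineTriplet μ S₁ ν₁ γ₁)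
    (h₂ : HasLevyKhintchineTriplet μ S₂ ν₂ γ₂) (z : EuclideanSpace ℝ (Fin d)) :
    lkExponent S₁ ν₁ γ₁ z = lkExponent S₂ ν₂ γ₂ z := by
  refine sub_eq_zero.1 (eq_zero_of_exp_eq_one (x₀ := (0 : EuclideanSpace ℝ (Fin d)))
    ((continuous_lkExponent S₁ h₁.isLevyMeasure γ₁).sub
      (continuous_lkExponent S₂ h₂.isLevyMeasure γ₂)) (fun z => ?_) (by simp [lkExponent_zero]) z)
  have h := (h₁.charFun_eq z).symm.trans (h₂.charFun_eq z)
  rw [Pi.sub_apply, Complex.exp_sub]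
  change Complex.exp (lkExponent S₁ ν₁ γ₁ z) = Complex.exp (lkExponent S₂ ν₂ γ₂ z) at h
  rw [h, div_self (Complex.exp_ne_zero _)]

/-- A second difference kills the terms linear in `z`, in particular the compensator, and leaves an
integrand that is the character times the nonnegative weight `1 - cos ⟨x, w⟩` of order `|x|²`. -/
theorem lkIntegrand_second_difference {d : ℕ} (z w x : EuclideanSpace ℝ (Fin d)) :
    lkIntegrand (z + w) x + lkIntegrand (z - w) x - 2 * lkIntegrand z x
      = -2 * ((1 - Real.cos (inner ℝ x w) : ℝ) * Complex.exp ((inner ℝ x z : ℝ) * Complex.I)) := by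
  unfold lkIntegrand
  simp only [inner_add_right, inner_sub_right]
  set a : ℝ := inner ℝ x z
  set b : ℝ := inner ℝ x w
  have := one_add_norm_sq_ne_zero x
  have h1 : Complex.exp (Complex.I * ((a + b : ℝ) : ℂ))
      = Complex.exp (a * Complex.I) * Complex.exp (b * Complex.I) := by
    rw [← Complex.exp_add]; congr 1; push_cast; ring
  have h2 : Complex.exp (Complex.I * ((a - b : ℝ) : ℂ))
      = Complex.exp (a * Complex.I) * Complex.exp (-b * Complex.I) := by
    rw [← Complex.exp_add]; congr 1; push_cast; ring
  have h3 : Complex.exp (Complex.I * (a : ℂ)) = Complex.exp (a * Complex.I) := by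
    rw [mul_comm]
  have h4 : (((1 - Real.cos b : ℝ)) : ℂ)
      = 1 - (Complex.exp (b * Complex.I) + Complex.exp (-b * Complex.I)) / 2 := by
    push_cast; rw [Complex.cos]
  rw [h1, h2, h3, h4]
  push_cast at this ⊢
  field_simp
  ring

/-- The drift disappears, the Gaussian part becomes independent of `z`, and the jump part becomes a
Fourier transform in `z`. The right side is therefore the Fourier transform of a finite measure with
an additional atom at the origin. -/
theorem lkExponent_second_difference {d : ℕ} (S : Matrix (Fin d) (Fin d) ℝ)
    {ν : Measure (EuclideanSpace ℝ (Fin d))} (h : IsLevyMeasure ν)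
    (γ z w : EuclideanSpace ℝ (Fin d)) :
    lkExponent S ν γ (z + w) + lkExponent S ν γ (z - w) - 2 * lkExponent S ν γ z
      = -2 * ((inner ℝ (S.toEuclideanLin w) w / 2 : ℝ)
        + ∫ x, (1 - Real.cos (inner ℝ x w) : ℝ) *
          Complex.exp ((inner ℝ x z : ℝ) * Complex.I) ∂ν) := by
  have hi := h.integrable_lkIntegrand
  have h1 : ∫ x, lkIntegrand (z + w) x ∂ν + ∫ x, lkIntegrand (z - w) x ∂ν
      - 2 * ∫ x, lkIntegrand z x ∂ν = -2 * ∫ x, (1 - Real.cos (inner ℝ x w) : ℝ)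
        * Complex.exp ((inner ℝ x z : ℝ) * Complex.I) ∂ν := by
    rw [← integral_const_mul, ← integral_const_mul, ← integral_add (hi _) (hi _),
      ← integral_sub (f := fun x => lkIntegrand (z + w) x + lkIntegrand (z - w) x)
        ((hi _).add (hi _)) ((hi _).const_mul _)]
    exact integral_congr_ae (.of_forall fun x => lkIntegrand_second_difference z w x)
  rw [mul_add, ← h1]
  unfold lkExponent
  simp only [map_add, map_sub, inner_add_right, inner_sub_right, inner_add_left, inner_sub_left]
  push_cast
  ring

theorem one_sub_cos_nonneg (t : ℝ) : 0 ≤ 1 - Real.cos t := sub_nonneg.2 (Real.cos_le_one t)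

theorem IsLevyMeasure.isFiniteMeasure_withDensity {d : ℕ} {ν : Measure (EuclideanSpace ℝ (Fin d))}
    (h : IsLevyMeasure ν) (w : EuclideanSpace ℝ (Fin d)) :
    IsFiniteMeasure (ν.withDensity fun x => ENNReal.ofReal (1 - Real.cos (inner ℝ x w))) := by
  refine isFiniteMeasure_withDensity_ofReal (Integrable.hasFiniteIntegral ?_)
  refine (h.integrable.const_mul (2 + ‖w‖ ^ 2)).mono' (by fun_prop) (.of_forall fun x => ?_)
  rw [Real.norm_of_nonneg (one_sub_cos_nonneg _)]
  have h1 := Real.one_sub_sq_div_two_le_cos (x := inner ℝ x w)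
  have h2 := Real.neg_one_le_cos (inner ℝ x w)
  have h3 : (inner ℝ x w) ^ 2 ≤ ‖w‖ ^ 2 * ‖x‖ ^ 2 := by
    rw [← sq_abs, ← mul_pow, mul_comm ‖w‖]
    exact pow_le_pow_left₀ (abs_nonneg _) (abs_real_inner_le_norm x w) 2
  rcases min_cases 1 (‖x‖ ^ 2) with ⟨hm, _⟩ | ⟨hm, _⟩ <;> rw [hm]
  · nlinarith [sq_nonneg ‖w‖]
  · nlinarith [sq_nonneg ‖x‖, sq_nonneg ‖w‖]

theorem HasLevyKhintchineTriplet.withDensity_eq {d : ℕ} {μ : Measure (EuclideanSpace ℝ (Fin d))}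
    {S₁ S₂ : Matrix (Fin d) (Fin d) ℝ} {ν₁ ν₂ : Measure (EuclideanSpace ℝ (Fin d))}
    {γ₁ γ₂ : EuclideanSpace ℝ (Fin d)} (h₁ : HasLevyKhintchineTriplet μ S₁ ν₁ γ₁)
    (h₂ : HasLevyKhintchineTriplet μ S₂ ν₂ γ₂) (w : EuclideanSpace ℝ (Fin d)) :
    (ν₁.withDensity fun x => ENNReal.ofReal (1 - Real.cos (inner ℝ x w)))
      = ν₂.withDensity fun x => ENNReal.ofReal (1 - Real.cos (inner ℝ x w)) := by
  -- The finite measure whose characteristic function is `-1/2` times the second difference of the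
  -- exponent. The Gaussian part sits in the atom at `0`.
  let m : Matrix (Fin d) (Fin d) ℝ → Measure (EuclideanSpace ℝ (Fin d)) →
      Measure (EuclideanSpace ℝ (Fin d)) := fun S ν =>
    (ν.withDensity fun x => ENNReal.ofReal (1 - Real.cos (inner ℝ x w)))
      + ENNReal.ofReal (inner ℝ (S.toEuclideanLin w) w / 2) • Measure.dirac 0
  have hfin : ∀ S ν, IsLevyMeasure ν → IsFiniteMeasure (m S ν) := by
    intro S ν h
    have := h.isFiniteMeasure_withDensity w
    have : IsFiniteMeasure (ENNReal.ofReal (inner ℝ (S.toEuclideanLin w) w / 2) •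
      (Measure.dirac 0 : Measure (EuclideanSpace ℝ (Fin d)))) :=
      Measure.smul_finite _ ENNReal.ofReal_ne_top
    infer_instance
  have hchar : ∀ S ν γ z, HasLevyKhintchineTriplet μ S ν γ → -2 * charFun (m S ν) z =
      lkExponent S ν γ (z + w) + lkExponent S ν γ (z - w) - 2 * lkExponent S ν γ z := by
    intro S ν γ z h
    rw [lkExponent_second_difference S h.isLevyMeasure γ z w]
    congr 1
    have := h.isLevyMeasure.isFiniteMeasure_withDensity w
    have hb : ∀ n : Measure (EuclideanSpace ℝ (Fin d)), IsFiniteMeasure n →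
        Integrable (fun x => Complex.exp ((inner ℝ x z : ℝ) * Complex.I)) n := fun n _ =>
      Integrable.of_bound (C := 1) (by fun_prop) (.of_forall fun x =>
        (Complex.norm_exp_ofReal_mul_I _).le)
    have hq : 0 ≤ inner ℝ (S.toEuclideanLin w) w / 2 := by
      have := h.posSemidef.dotProduct_mulVec_nonneg w.ofLp
      have h2 : (inner ℝ (S.toEuclideanLin w) w : ℝ) = star w.ofLp ⬝ᵥ S.mulVec w.ofLp := by
        rw [EuclideanSpace.inner_eq_star_dotProduct]
        simp
      rw [h2]
      positivity
    rw [charFun_apply, integral_add_measure (hb _ inferInstance)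
      (hb _ (Measure.smul_finite _ ENNReal.ofReal_ne_top)), integral_smul_measure,
      integral_dirac, integral_withDensity_eq_integral_toReal_smul (by fun_prop)
        (.of_forall fun x => ENNReal.ofReal_lt_top)]
    rw [add_comm]
    congr 1
    · simp [ENNReal.toReal_ofReal hq]
    · refine integral_congr_ae (.of_forall fun x => ?_)
      simp only [ENNReal.toReal_ofReal (one_sub_cos_nonneg _), Complex.real_smul]
  have := hfin S₁ ν₁ h₁.isLevyMeasure
  have := hfin S₂ ν₂ h₂.isLevyMeasure
  have hm : m S₁ ν₁ = m S₂ ν₂ := by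
    refine Measure.ext_of_charFun (funext fun z => ?_)
    refine mul_left_cancel₀ (by norm_num : (-2 : ℂ) ≠ 0) ?_
    rw [hchar S₁ ν₁ γ₁ z h₁, hchar S₂ ν₂ γ₂ z h₂]
    simp only [h₁.lkExponent_eq h₂]
  ext B hB
  -- The weight vanishes at `x = 0`, so removing the origin discards exactly the Gaussian atom.
  have key : ∀ S ν, (ν.withDensity fun x => ENNReal.ofReal (1 - Real.cos (inner ℝ x w))) B
      = m S ν (B \ {0}) := by
    intro S ν
    have h0 : (ν.withDensity fun x => ENNReal.ofReal (1 - Real.cos (inner ℝ x w))) {0} = 0 := by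
      rw [withDensity_apply _ (measurableSet_singleton _), lintegral_singleton]
      simp
    simp only [m, Measure.add_apply, Measure.smul_apply]
    rw [measure_sdiff_null h0, Measure.dirac_apply' _ (hB.diff (measurableSet_singleton _))]
    simp
  rw [key S₁ ν₁, key S₂ ν₂, hm]

/-- Otherwise `t` and `√2 t` would both be multiples of `2π`, making `√2` rational. Two frequencies
per coordinate thus give a weight with no zeros except the origin. -/
theorem exists_cos_ne_one {t : ℝ} (ht : t ≠ 0) : Real.cos t ≠ 1 ∨ Real.cos (√2 * t) ≠ 1 := by
  by_contra! h
  obtain ⟨m, hm⟩ := (Real.cos_eq_one_iff _).1 h.1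
  obtain ⟨n, hn⟩ := (Real.cos_eq_one_iff _).1 h.2
  have hm0 : (m : ℝ) ≠ 0 := by
    rintro h0
    rw [h0, zero_mul] at hm
    exact ht hm.symm
  have hpi := Real.two_pi_pos.ne'
  refine irrational_sqrt_two ⟨(n : ℚ) / m, ?_⟩
  push_cast
  rw [div_eq_iff hm0]
  rw [← hm] at hn
  apply mul_right_cancel₀ hpi
  linarith

theorem HasLevyKhintchineTriplet.levyMeasure_unique {d : ℕ}
    {μ : Measure (EuclideanSpace ℝ (Fin d))}
    {S₁ S₂ : Matrix (Fin d) (Fin d) ℝ} {ν₁ ν₂ : Measure (EuclideanSpace ℝ (Fin d))}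
    {γ₁ γ₂ : EuclideanSpace ℝ (Fin d)} (h₁ : HasLevyKhintchineTriplet μ S₁ ν₁ γ₁)
    (h₂ : HasLevyKhintchineTriplet μ S₂ ν₂ γ₂) : ν₁ = ν₂ := by
  let g : EuclideanSpace ℝ (Fin d) → EuclideanSpace ℝ (Fin d) → ℝ≥0∞ := fun w x =>
    ENNReal.ofReal (1 - Real.cos (inner ℝ x w))
  have hg : ∀ w, Measurable (g w) := fun w => by fun_prop
  let e : Fin d → EuclideanSpace ℝ (Fin d) := fun j => EuclideanSpace.single j 1
  -- A finite sum of the weights `1 - cos ⟨x, w⟩`, positive for every `x ≠ 0`. The weighted Lévy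
  -- measures agree, and dividing by `F` recovers the measures themselves.
  let F : EuclideanSpace ℝ (Fin d) → ℝ≥0∞ := fun x =>
    ∑ j, (g (e j) x + g (√2 • e j) x)
  have hF : Measurable F := by fun_prop
  have hFν : ∀ ν : Measure (EuclideanSpace ℝ (Fin d)), ν.withDensity F
      = Measure.sum fun j => ν.withDensity (g (e j)) + ν.withDensity (g (√2 • e j)) := by
    intro ν
    ext B hB
    rw [Measure.sum_apply _ hB, withDensity_apply _ hB, tsum_fintype]
    simp only [F]
    rw [lintegral_finsetSum (f := fun j x => g (e j) x + g (√2 • e j) x) _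
      fun j _ => (hg _).add (hg _)]
    refine Finset.sum_congr rfl fun j _ => ?_
    rw [lintegral_add_left (hg _), Measure.add_apply, withDensity_apply _ hB,
      withDensity_apply _ hB]
  have hFeq : ν₁.withDensity F = ν₂.withDensity F := by
    rw [hFν, hFν]
    congr 1
    funext j
    rw [h₁.withDensity_eq h₂ (e j), h₁.withDensity_eq h₂ (√2 • e j)]
  have hFtop : ∀ x, F x ≠ ⊤ := fun x => by simp [F, g]
  have hF0 : ∀ x, x ≠ 0 → F x ≠ 0 := by
    intro x hx h0
    obtain ⟨j, hj⟩ : ∃ j, x j ≠ 0 := by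
      by_contra! h
      exact hx (by ext j; simpa using h j)
    have := (Finset.sum_eq_zero_iff.1 h0 j (Finset.mem_univ _))
    simp only [add_eq_zero, g, e, ENNReal.ofReal_eq_zero, inner_smul_right,
      EuclideanSpace.inner_single_right, sub_nonpos] at this
    rcases exists_cos_ne_one hj with h | h
    · exact h (le_antisymm (Real.cos_le_one _) (by simpa using this.1))
    · exact h (le_antisymm (Real.cos_le_one _) (by simpa using this.2))
  have hinv : ∀ ν, IsLevyMeasure ν → (ν.withDensity F).withDensity (fun x => (F x)⁻¹) = ν := by
    intro ν hν
    refine withDensity_inv_same hF ?_ (.of_forall hFtop)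
    have : ∀ᵐ x ∂ν, x ≠ 0 := by simpa [ae_iff] using hν.zero
    filter_upwards [this] with x hx using hF0 x hx
  rw [← hinv ν₁ h₁.isLevyMeasure, hFeq, hinv ν₂ h₂.isLevyMeasure]

/-! ### Radial transformations -/

theorem norm_smul_inv_norm_smul {d : ℕ} {x : EuclideanSpace ℝ (Fin d)} (hx : x ≠ 0) {t : ℝ}
    (ht : 0 < t) : ‖t • (‖x‖⁻¹ • x)‖ = t := by
  rw [norm_smul, norm_smul, norm_inv, norm_norm, inv_mul_cancel₀ (norm_ne_zero_iff.2 hx), mul_one,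
    Real.norm_of_nonneg ht.le]

theorem inv_norm_smul_smul_inv_norm_smul {d : ℕ} {x : EuclideanSpace ℝ (Fin d)} (hx : x ≠ 0)
    {t : ℝ} (ht : 0 < t) :
    ‖t • (‖x‖⁻¹ • x)‖⁻¹ • (t • (‖x‖⁻¹ • x)) = ‖x‖⁻¹ • x := by
  rw [norm_smul_inv_norm_smul hx ht, inv_smul_smul₀ ht.ne']

/-- The measure obtained from `η` by replacing each point `x ≠ 0` by the law with density
`k · |x|` on the ray through `x`. -/
def rayTransform {d : ℕ} (k : ℝ → ℝ → ℝ≥0∞) (η : Measure (EuclideanSpace ℝ (Fin d))) :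
    Measure (EuclideanSpace ℝ (Fin d)) :=
  (η.restrict {0}ᶜ).bind fun x =>
    ((volume.restrict (Ioi 0)).withDensity (k · ‖x‖)).map (fun r : ℝ => r • (‖x‖⁻¹ • x))

theorem lintegral_rayTransform {d : ℕ} {k : ℝ → ℝ → ℝ≥0∞} (hk : Measurable (Function.uncurry k))
    (η : Measure (EuclideanSpace ℝ (Fin d))) {F : EuclideanSpace ℝ (Fin d) → ℝ≥0∞}
    (hF : Measurable F) :
    ∫⁻ y, F y ∂(rayTransform k η)
      = ∫⁻ x in {0}ᶜ, (∫⁻ r in Ioi (0 : ℝ), k r ‖x‖ * F (r • (‖x‖⁻¹ • x))) ∂η := by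
  have h1 : ∀ x : EuclideanSpace ℝ (Fin d), Measurable fun r : ℝ => r • (‖x‖⁻¹ • x) :=
    fun x => by fun_prop
  have h2 : ∀ x : EuclideanSpace ℝ (Fin d), Measurable fun r : ℝ => k r ‖x‖ :=
    fun x => hk.comp (by fun_prop : Measurable fun r : ℝ => (r, ‖x‖))
  have h3 : ∀ (x : EuclideanSpace ℝ (Fin d)) {G : EuclideanSpace ℝ (Fin d) → ℝ≥0∞},
      Measurable G → ∫⁻ y, G y ∂(((volume.restrict (Ioi 0)).withDensity (k · ‖x‖)).map
        (fun r : ℝ => r • (‖x‖⁻¹ • x)))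
        = ∫⁻ r in Ioi (0 : ℝ), k r ‖x‖ * G (r • (‖x‖⁻¹ • x)) := by
    intro x G hG
    rw [lintegral_map hG (h1 x), lintegral_withDensity_eq_lintegral_mul _ (h2 x)
      (g := fun r : ℝ => G (r • (‖x‖⁻¹ • x))) (hG.comp (h1 x))]
    rfl
  have h4 : Measurable fun x : EuclideanSpace ℝ (Fin d) =>
      ((volume.restrict (Ioi 0)).withDensity (k · ‖x‖)).map (fun r : ℝ => r • (‖x‖⁻¹ • x)) := by
    refine Measure.measurable_of_measurable_coe _ fun B hB => ?_
    simp_rw [← lintegral_indicator_one hB, h3 _ (measurable_one.indicator hB)]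
    refine Measurable.lintegral_prod_right (f := fun (x : EuclideanSpace ℝ (Fin d)) (r : ℝ) =>
      k r ‖x‖ * B.indicator 1 (r • (‖x‖⁻¹ • x))) ?_
    refine (hk.comp (by fun_prop : Measurable fun p : EuclideanSpace ℝ (Fin d) × ℝ =>
      (p.2, ‖p.1‖))).mul ((measurable_one.indicator hB).comp (by fun_prop))
  rw [rayTransform, Measure.lintegral_bind h4.aemeasurable hF.aemeasurable]
  simp_rw [h3 _ hF]

theorem measurable_lintegral_ray {d : ℕ} {k : ℝ → ℝ → ℝ≥0∞}
    (hk : Measurable (Function.uncurry k)) {F : EuclideanSpace ℝ (Fin d) → ℝ≥0∞}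
    (hF : Measurable F) :
    Measurable fun x => ∫⁻ r in Ioi (0 : ℝ), k r ‖x‖ * F (r • (‖x‖⁻¹ • x)) := by
  refine Measurable.lintegral_prod_right (f := fun (x : EuclideanSpace ℝ (Fin d)) (r : ℝ) =>
      k r ‖x‖ * F (r • (‖x‖⁻¹ • x))) ?_
  exact (hk.comp (by fun_prop : Measurable fun p : EuclideanSpace ℝ (Fin d) × ℝ =>
      (p.2, ‖p.1‖))).mul (hF.comp (by fun_prop))

theorem rayTransform_congr {d : ℕ} {k l : ℝ → ℝ → ℝ≥0∞} (hk : Measurable (Function.uncurry k))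
    (hl : Measurable (Function.uncurry l)) (h : ∀ r s, 0 < r → 0 < s → k r s = l r s)
    (η : Measure (EuclideanSpace ℝ (Fin d))) : rayTransform k η = rayTransform l η := by
  refine Measure.ext_of_lintegral _ fun F hF => ?_
  rw [lintegral_rayTransform hk _ hF, lintegral_rayTransform hl _ hF]
  refine setLIntegral_congr_fun (measurableSet_singleton 0).compl fun x hx => ?_
  refine setLIntegral_congr_fun measurableSet_Ioi fun r hr => ?_
  simp only [h r ‖x‖ hr (norm_pos_iff.2 hx)]

/-- The intermediate point stays on the ray through `x`, so only the radial kernels are composed, by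
Tonelli. -/
theorem rayTransform_comp {d : ℕ} {k l : ℝ → ℝ → ℝ≥0∞} (hk : Measurable (Function.uncurry k))
    (hl : Measurable (Function.uncurry l)) (η : Measure (EuclideanSpace ℝ (Fin d))) :
    rayTransform k (rayTransform l η)
      = rayTransform (fun r s => ∫⁻ t in Ioi (0 : ℝ), k r t * l t s) η := by
  have hkl : Measurable (Function.uncurry fun r s => ∫⁻ t in Ioi (0 : ℝ), k r t * l t s) :=
    Measurable.lintegral_prod_right' (f := fun p : (ℝ × ℝ) × ℝ => k p.1.1 p.2 * l p.2 p.1.2)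
      ((hk.comp (by fun_prop : Measurable fun p : (ℝ × ℝ) × ℝ => (p.1.1, p.2))).mul
        (hl.comp (by fun_prop : Measurable fun p : (ℝ × ℝ) × ℝ => (p.2, p.1.2))))
  refine Measure.ext_of_lintegral _ fun F hF => ?_
  have h0 : MeasurableSet ({0}ᶜ : Set (EuclideanSpace ℝ (Fin d))) :=
    (measurableSet_singleton 0).compl
  rw [lintegral_rayTransform hk _ hF, lintegral_rayTransform hkl _ hF, ← lintegral_indicator h0,
    lintegral_rayTransform hl _ ((measurable_lintegral_ray hk hF).indicator h0)]
  refine setLIntegral_congr_fun h0 fun x hx => ?_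
  have h1 : ∀ t ∈ Ioi (0 : ℝ), l t ‖x‖ * ({0}ᶜ : Set (EuclideanSpace ℝ (Fin d))).indicator
      (fun x => ∫⁻ r in Ioi (0 : ℝ), k r ‖x‖ * F (r • (‖x‖⁻¹ • x))) (t • (‖x‖⁻¹ • x))
      = ∫⁻ r in Ioi (0 : ℝ), k r t * l t ‖x‖ * F (r • (‖x‖⁻¹ • x)) := by
    intro t ht
    have hne : t • (‖x‖⁻¹ • x) ∈ ({0}ᶜ : Set (EuclideanSpace ℝ (Fin d))) := by
      refine norm_ne_zero_iff.1 ?_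
      rw [norm_smul_inv_norm_smul hx ht]; exact (mem_Ioi.1 ht).ne'
    rw [indicator_of_mem hne, inv_norm_smul_smul_inv_norm_smul hx ht,
      norm_smul_inv_norm_smul hx ht, ← lintegral_const_mul]
    · refine lintegral_congr fun r => ?_
      rw [← mul_assoc, mul_comm (l t _)]
    · exact (hk.comp (by fun_prop : Measurable fun r : ℝ => (r, t))).mul (hF.comp (by fun_prop))
  rw [setLIntegral_congr_fun measurableSet_Ioi h1, lintegral_lintegral_swap]
  · refine lintegral_congr fun r => ?_
    rw [lintegral_mul_const]
    exact (hk.comp (by fun_prop : Measurable fun t : ℝ => (r, t))).mul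
      (hl.comp (by fun_prop : Measurable fun t : ℝ => (t, ‖x‖)))
  · refine Measurable.aemeasurable ?_
    exact ((hk.comp (by fun_prop : Measurable fun p : ℝ × ℝ => (p.2, p.1))).mul
      (hl.comp (by fun_prop : Measurable fun p : ℝ × ℝ => (p.1, ‖x‖)))).mul
      (hF.comp (by fun_prop))

theorem rayTransform_withDensity {d : ℕ} {k : ℝ → ℝ → ℝ≥0∞} (hk : Measurable (Function.uncurry k))
    {c : ℝ → ℝ≥0∞} (hc : Measurable c) (η : Measure (EuclideanSpace ℝ (Fin d))) :
    rayTransform k (η.withDensity fun x => c ‖x‖) = rayTransform (fun r s => c s * k r s) η := by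
  have hck : Measurable (Function.uncurry fun r s => c s * k r s) :=
    (hc.comp measurable_snd).mul hk
  refine Measure.ext_of_lintegral _ fun F hF => ?_
  rw [lintegral_rayTransform hk _ hF, lintegral_rayTransform hck _ hF,
    restrict_withDensity (measurableSet_singleton 0).compl,
    lintegral_withDensity_eq_lintegral_mul _ (by fun_prop) (measurable_lintegral_ray hk hF)]
  refine lintegral_congr fun x => ?_
  rw [Pi.mul_apply, ← lintegral_const_mul]
  · simp_rw [mul_assoc]
  · exact (hk.comp (by fun_prop : Measurable fun r : ℝ => (r, ‖x‖))).mul (hF.comp (by fun_prop))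

theorem rayTransform_zero_singleton {d : ℕ} {k : ℝ → ℝ → ℝ≥0∞}
    (hk : Measurable (Function.uncurry k)) (η : Measure (EuclideanSpace ℝ (Fin d))) :
    rayTransform k η {0} = 0 := by
  have h0 := measurableSet_singleton (0 : EuclideanSpace ℝ (Fin d))
  rw [← lintegral_indicator_one h0, lintegral_rayTransform hk _ (measurable_one.indicator h0)]
  rw [setLIntegral_congr_fun (g := fun _ => 0) h0.compl, lintegral_zero]
  intro x hx
  simp only
  rw [setLIntegral_congr_fun (g := fun _ => 0) measurableSet_Ioi, lintegral_zero]
  intro r hr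
  have : r • (‖x‖⁻¹ • x) ∉ ({0} : Set (EuclideanSpace ℝ (Fin d))) := by
    refine norm_ne_zero_iff.1 ?_
    rw [norm_smul_inv_norm_smul hx hr]; exact (mem_Ioi.1 hr).ne'
  simp only [indicator_of_notMem this, mul_zero]

theorem lintegral_Ioi_comp_mul_left {a : ℝ} (ha : 0 < a) {G : ℝ → ℝ≥0∞} (hG : Measurable G) :
    ∫⁻ u in Ioi (0 : ℝ), G u = ENNReal.ofReal a * ∫⁻ r in Ioi (0 : ℝ), G (a * r) := by
  rw [← lintegral_indicator measurableSet_Ioi, ← lintegral_indicator measurableSet_Ioi]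
  nth_rewrite 1 [← Real.smul_map_volume_mul_left ha.ne']
  rw [lintegral_smul_measure, lintegral_map (hG.indicator measurableSet_Ioi) (by fun_prop),
    abs_of_pos ha, smul_eq_mul]
  congr 1
  refine lintegral_congr fun r => ?_
  by_cases hr : 0 < r
  · rw [indicator_of_mem (show a * r ∈ Ioi 0 from mul_pos ha hr),
      indicator_of_mem (show r ∈ Ioi 0 from hr)]
  · rw [indicator_of_notMem (show a * r ∉ Ioi 0 from fun h => hr (pos_of_mul_pos_right h ha.le)),
      indicator_of_notMem (show r ∉ Ioi 0 from hr)]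

/-- The exponential kernel `exp (-r ^ p / s)`. -/
def expKernel (p : ℕ) (r s : ℝ) : ℝ≥0∞ := ENNReal.ofReal (Real.exp (-(r ^ p / s)))

theorem measurable_expKernel (p : ℕ) : Measurable (Function.uncurry (expKernel p)) := by
  unfold expKernel Function.uncurry; fun_prop

theorem measurable_inv_mul_expKernel (p : ℕ) :
    Measurable (Function.uncurry fun r s : ℝ => ENNReal.ofReal s⁻¹ * expKernel p r s) :=
  (by fun_prop : Measurable fun p : ℝ × ℝ => ENNReal.ofReal p.2⁻¹).mul (measurable_expKernel p)

theorem arcsine_eq_rayTransform {d : ℕ} (ν : Measure (EuclideanSpace ℝ (Fin d))) :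
    arcsine ν = rayTransform (fun r s => ENNReal.ofReal (arcsineDensity r s)) ν := rfl

theorem measurable_ofReal_arcsineDensity :
    Measurable (Function.uncurry fun r s => ENNReal.ofReal (arcsineDensity r s)) :=
  measurable_arcsineDensity.ennreal_ofReal

theorem lintegral_upsilonZero {d : ℕ} (ρ : Measure (EuclideanSpace ℝ (Fin d))) [SFinite ρ]
    {F : EuclideanSpace ℝ (Fin d) → ℝ≥0∞} (hF : Measurable F) :
    ∫⁻ y, F y ∂(upsilonZero ρ)
      = ∫⁻ x, (∫⁻ u in Ioi (0 : ℝ), ENNReal.ofReal (Real.exp (-u)) * F (u • x)) ∂ρ := by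
  have hm : Measurable (fun p : ℝ × EuclideanSpace ℝ (Fin d) => p.1 • p.2) := by fun_prop
  rw [upsilonZero, lintegral_map hF hm,
    lintegral_prod_symm (fun p : ℝ × EuclideanSpace ℝ (Fin d) => F (p.1 • p.2))
      (hF.comp hm).aemeasurable]
  refine lintegral_congr fun x => ?_
  rw [lintegral_withDensity_eq_lintegral_mul _ (by fun_prop) (g := fun u : ℝ => F (u • x))
    (hF.comp (by fun_prop))]
  rfl

/-- Substitute `u = r / |x|` in `∫ F(u x) e^{-u} du`; the factor `s⁻¹` is the Jacobian. -/
theorem upsilonZero_eq_rayTransform {d : ℕ} (ρ : Measure (EuclideanSpace ℝ (Fin d))) [SFinite ρ]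
    (h0 : ρ {0} = 0) :
    upsilonZero ρ = rayTransform (fun r s => ENNReal.ofReal s⁻¹ * expKernel 1 r s) ρ := by
  refine Measure.ext_of_lintegral _ fun F hF => ?_
  rw [lintegral_rayTransform (measurable_inv_mul_expKernel 1) _ hF, lintegral_upsilonZero ρ hF]
  have h1 : ρ.restrict {0}ᶜ = ρ := by
    rw [Measure.restrict_eq_self_of_ae_mem]
    simpa [ae_iff] using h0
  nth_rewrite 1 [← h1]
  refine setLIntegral_congr_fun (measurableSet_singleton 0).compl fun x hx => ?_
  have hx0 : 0 < ‖x‖ := norm_pos_iff.2 hx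
  rw [lintegral_Ioi_comp_mul_left (inv_pos.2 hx0) (by fun_prop), ← lintegral_const_mul _
    (by fun_prop)]
  refine lintegral_congr fun r => ?_
  simp only [expKernel, pow_one]
  rw [smul_smul, mul_comm r, div_eq_inv_mul, mul_assoc]

/-! ### The arcsine kernel -/

theorem lintegral_rpow_mul_exp {s : ℝ} (hs : 0 < s) :
    ∫⁻ t in Ioi (0 : ℝ), ENNReal.ofReal (t ^ (-(1 / 2) : ℝ) * Real.exp (-(t / s)))
      = ENNReal.ofReal (√Real.pi * √s) := by
  have h := Real.integral_rpow_mul_exp_neg_mul_Ioi (a := 1 / 2) (r := s⁻¹) (by norm_num)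
    (inv_pos.2 hs)
  have h1 : (1 / s⁻¹) ^ (1 / 2 : ℝ) * Real.Gamma (1 / 2) = √Real.pi * √s := by
    rw [Real.Gamma_one_half_eq, one_div, inv_inv, ← Real.sqrt_eq_rpow, mul_comm]
  have h2 : ∀ t : ℝ, t ^ ((1 / 2 : ℝ) - 1) * Real.exp (-(s⁻¹ * t))
      = t ^ (-(1 / 2) : ℝ) * Real.exp (-(t / s)) := by
    intro t; rw [div_eq_inv_mul t s, show (1 / 2 : ℝ) - 1 = -(1 / 2) by norm_num]
  simp_rw [h2, h1] at h
  rw [← h, ofReal_integral_eq_lintegral_ofReal]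
  -- A non-integrable function has Bochner integral `0`, whereas the value found is positive.
  · by_contra hni
    rw [integral_undef hni] at h
    have : 0 < √Real.pi * √s := by have := Real.pi_pos; positivity
    exact this.ne h
  · filter_upwards [ae_restrict_mem measurableSet_Ioi] with t ht
    have : (0 : ℝ) < t := ht
    positivity

/-- The kernel vanishes for `t ≤ r²`. The shift `t ↦ t + r²` pulls out `exp (-r² / s)` and leaves
the integral for `Γ(1/2) = √π`. -/
theorem lintegral_arcsineDensity_mul_expKernel {r s : ℝ} (hr : 0 < r) (hs : 0 < s) :
    ∫⁻ t in Ioi (0 : ℝ), ENNReal.ofReal (arcsineDensity r t) * expKernel 1 t s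
      = ENNReal.ofReal (2 / √Real.pi * √s) * expKernel 2 r s := by
  have hpi := Real.pi_pos
  have h1 : ∫⁻ t in Ioi (0 : ℝ), ENNReal.ofReal (arcsineDensity r t) * expKernel 1 t s
      = ∫⁻ t in Ioi (r ^ 2), ENNReal.ofReal (arcsineDensity r t) * expKernel 1 t s := by
    rw [← lintegral_indicator measurableSet_Ioi, ← lintegral_indicator measurableSet_Ioi]
    refine lintegral_congr fun t => ?_
    by_cases ht : r ^ 2 < t
    · rw [indicator_of_mem (show t ∈ Ioi 0 from lt_of_le_of_lt (sq_nonneg r) ht),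
        indicator_of_mem (show t ∈ Ioi (r ^ 2) from ht)]
    · rw [indicator_of_notMem (show t ∉ Ioi (r ^ 2) from ht)]
      have : arcsineDensity r t = 0 := by
        rw [arcsineDensity, if_neg]
        rintro ⟨_, h⟩
        exact ht ((Real.lt_sqrt hr.le).1 h)
      simp [this, indicator]
  have hmp := measurePreserving_add_right (volume : Measure ℝ) (r ^ 2)
  have hpre : (fun x => x + r ^ 2) ⁻¹' Ioi (r ^ 2) = Ioi (0 : ℝ) := by ext; simp
  rw [h1, ← hmp.setLIntegral_comp_preimage measurableSet_Ioi, hpre]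
  · have h2 : ∀ t ∈ Ioi (0 : ℝ), ENNReal.ofReal (arcsineDensity r (t + r ^ 2))
        * expKernel 1 (t + r ^ 2) s = ENNReal.ofReal (2 / Real.pi * Real.exp (-(r ^ 2 / s)))
          * ENNReal.ofReal (t ^ (-(1 / 2) : ℝ) * Real.exp (-(t / s))) := by
      intro t ht
      have ht0 : (0 : ℝ) < t := ht
      rw [arcsineDensity, if_pos ⟨hr, Real.lt_sqrt_of_sq_lt (by linarith)⟩, expKernel,
        add_sub_cancel_right, ← ENNReal.ofReal_mul (by positivity),
          ← ENNReal.ofReal_mul (by positivity)]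
      congr 1
      rw [pow_one, add_div, neg_add, Real.exp_add]
      ring
    rw [setLIntegral_congr_fun measurableSet_Ioi h2, lintegral_const_mul _ (by fun_prop),
      lintegral_rpow_mul_exp hs, expKernel, ← ENNReal.ofReal_mul (by positivity),
      ← ENNReal.ofReal_mul (by positivity)]
    congr 1
    have : √Real.pi * √Real.pi = Real.pi := Real.mul_self_sqrt hpi.le
    have h3 : √Real.pi ≠ 0 := by positivity
    field_simp
    rw [sq, this]
  · exact (measurable_ofReal_arcsineDensity.comp (by fun_prop : Measurable fun t : ℝ =>
      (r, t))).mul ((measurable_expKernel 1).comp (by fun_prop : Measurable fun t : ℝ => (t, s)))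

/-- The bridge between the two classes: the arcsine transformation turns the exponent `r` into `r²`
at the price of an explicit, invertible weight on the mixing measure. -/
theorem arcsine_rayTransform_expKernel {d : ℕ} (η : Measure (EuclideanSpace ℝ (Fin d))) :
    arcsine (rayTransform (expKernel 1) η) = rayTransform (expKernel 2)
      (η.withDensity fun x => ENNReal.ofReal (2 / √Real.pi * √‖x‖)) := by
  rw [arcsine_eq_rayTransform, rayTransform_comp measurable_ofReal_arcsineDensity
    (measurable_expKernel 1), rayTransform_withDensity (measurable_expKernel 2)
      (c := fun s => ENNReal.ofReal (2 / √Real.pi * √s)) (by fun_prop)]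
  refine rayTransform_congr ?_ ?_ (fun r s hr hs => lintegral_arcsineDensity_mul_expKernel hr hs) η
  · exact Measurable.lintegral_prod_right' (f := fun p : (ℝ × ℝ) × ℝ =>
      ENNReal.ofReal (arcsineDensity p.1.1 p.2) * expKernel 1 p.2 p.1.2)
      ((measurable_ofReal_arcsineDensity.comp
        (by fun_prop : Measurable fun p : (ℝ × ℝ) × ℝ => (p.1.1, p.2))).mul
      ((measurable_expKernel 1).comp (by fun_prop : Measurable fun p : (ℝ × ℝ) × ℝ =>
        (p.2, p.1.2))))
  · exact (by fun_prop : Measurable fun p : ℝ × ℝ => ENNReal.ofReal (2 / √Real.pi * √p.2)).mul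
      (measurable_expKernel 2)

/-! ### Moments of measures on the unit interval -/

/-- By Weierstrass approximation, one sequence of polynomials serves all finite measures at once.
This independence of `P` lets both equality and measurability pass from moments to integrals of
continuous functions. -/
theorem exists_polynomial_tendsto_integral (f : C(Icc (0 : ℝ) 1, ℝ)) :
    ∃ p : ℕ → Polynomial ℝ, ∀ (P : Measure (Icc (0 : ℝ) 1)) [IsFiniteMeasure P],
      Tendsto (fun n => ∫ x, (p n).eval (x : ℝ) ∂P) atTop (𝓝 (∫ x, f x ∂P)) := by
  choose p hp using fun n : ℕ => exists_polynomial_near_continuousMap 0 1 f (1 / ((n : ℝ) + 1))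
    Nat.one_div_pos_of_nat
  have hd : ∀ n (x : Icc (0 : ℝ) 1), |(p n).eval (x : ℝ) - f x| ≤ 1 / ((n : ℝ) + 1) := fun n x =>
    (((p n).toContinuousMapOn _ - f).norm_coe_le_norm x).trans (hp n).le
  refine ⟨p, fun P _ => ?_⟩
  refine tendsto_integral_of_dominated_convergence (fun _ => ‖f‖ + 1) (fun n => ?_)
    (integrable_const _) (fun n => .of_forall fun x => ?_) (.of_forall fun x => ?_)
  · exact ((p n).continuous.comp continuous_subtype_val).aestronglyMeasurable
  · have h1 : (1 : ℝ) / (n + 1) ≤ 1 := by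
      rw [div_le_one (by positivity)]; linarith [(n.cast_nonneg : (0 : ℝ) ≤ n)]
    have h2 := f.norm_coe_le_norm x
    have h3 := hd n x
    rw [Real.norm_eq_abs] at h2 ⊢
    have := abs_add_le ((p n).eval (x : ℝ) - f x) (f x)
    rw [sub_add_cancel] at this
    linarith
  · rw [tendsto_iff_dist_tendsto_zero]
    exact squeeze_zero (fun _ => dist_nonneg) (fun n => hd n x)
      tendsto_one_div_add_atTop_nhds_zero_nat

theorem integral_polynomial_eval (P : Measure (Icc (0 : ℝ) 1)) [IsFiniteMeasure P]
    (p : Polynomial ℝ) : ∫ x, p.eval (x : ℝ) ∂P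
      = ∑ k ∈ Finset.range (p.natDegree + 1), p.coeff k * ∫ x, (x : ℝ) ^ k ∂P := by
  simp_rw [Polynomial.eval_eq_sum_range, ← integral_const_mul]
  refine integral_finsetSum _ fun k _ => ?_
  refine Continuous.integrable_of_hasCompactSupport (by fun_prop) ?_
  exact HasCompactSupport.of_compactSpace _

theorem ext_of_moments {P Q : Measure (Icc (0 : ℝ) 1)} [IsFiniteMeasure P] [IsFiniteMeasure Q]
    (h : ∀ k : ℕ, ∫ x, (x : ℝ) ^ k ∂P = ∫ x, (x : ℝ) ^ k ∂Q) : P = Q := by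
  refine ext_of_forall_integral_eq_of_IsFiniteMeasure fun f => ?_
  obtain ⟨p, hp⟩ := exists_polynomial_tendsto_integral f.toContinuousMap
  refine tendsto_nhds_unique (hp P) ?_
  simp_rw [integral_polynomial_eval, h, ← integral_polynomial_eval]
  exact hp Q

/-- Measurability spreads from moments to integrals of continuous functions, then to closed sets by
outer approximation, and finally to all Borel sets since closed sets form a generating π-system. -/
theorem measurable_of_moments {α : Type*} [MeasurableSpace α] {P : α → Measure (Icc (0 : ℝ) 1)}
    [∀ a, IsFiniteMeasure (P a)] (h : ∀ k : ℕ, Measurable fun a => ∫ x, (x : ℝ) ^ k ∂(P a)) :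
    Measurable P := by
  have hc : ∀ f : C(Icc (0 : ℝ) 1, ℝ), Measurable fun a => ∫ x, f x ∂(P a) := by
    intro f
    obtain ⟨p, hp⟩ := exists_polynomial_tendsto_integral f
    refine measurable_of_tendsto_metrizable (f := fun n a => ∫ x, (p n).eval (x : ℝ) ∂(P a))
      (fun n => ?_) (tendsto_pi_nhds.2 fun a => hp (P a))
    simp_rw [integral_polynomial_eval]
    exact Finset.measurable_fun_sum _ fun k _ => (h k).const_mul _
  have hF : ∀ F : Set (Icc (0 : ℝ) 1), IsClosed F → Measurable fun a => P a F := by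
    intro F hF
    refine measurable_of_tendsto_metrizable
      (f := fun n a => ∫⁻ x, (hF.apprSeq n x : ℝ≥0∞) ∂(P a)) (fun n => ?_)
      (tendsto_pi_nhds.2 fun a => HasOuterApproxClosed.tendsto_lintegral_apprSeq hF (P a))
    have : ∀ a, ∫⁻ x, (hF.apprSeq n x : ℝ≥0∞) ∂(P a)
        = ENNReal.ofReal (∫ x, (hF.apprSeq n x : ℝ) ∂(P a)) := by
      intro a
      rw [ofReal_integral_eq_lintegral_ofReal]
      · simp
      · refine Continuous.integrable_of_hasCompactSupport (by fun_prop) ?_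
        exact HasCompactSupport.of_compactSpace _
      · exact .of_forall fun x => NNReal.coe_nonneg _
    simp_rw [this]
    exact (hc ⟨fun x => (hF.apprSeq n x : ℝ), by fun_prop⟩).ennreal_ofReal
  refine Measurable.measure_of_isPiSystem (S := {s | IsClosed s}) ?_ isPiSystem_isClosed hF
    (hF univ isClosed_univ)
  rw [← borel_eq_generateFrom_isClosed]
  exact BorelSpace.measurable_eq

/-! ### Injectivity of the arcsine transformation -/

/-- Abel inversion: in the variable `r²` the integrand is an arcsine density on `(u, s)`, whose
total mass does not depend on the endpoints. -/
theorem lintegral_arcsineDensity_mul_abel {u s : ℝ} (hu : 0 < u) (hus : u < s) :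
    ∫⁻ r in Ioi (0 : ℝ), ENNReal.ofReal (arcsineDensity r s)
      * (if u < r ^ 2 then ENNReal.ofReal (r * (r ^ 2 - u) ^ (-(1 / 2) : ℝ)) else 0) = 1 := by
  have hs : 0 < s := hu.trans hus
  have hus' : √u < √s := Real.sqrt_lt_sqrt hu.le hus
  have h0u : 0 < √u := Real.sqrt_pos.2 hu
  -- The affine map sends `r² ∈ [u, s]` to `[-1, 1]`, so this primitive increases from `-1/2` to
  -- `1/2`.
  let G : ℝ → ℝ := fun r => 1 / Real.pi * Real.arcsin ((2 * r ^ 2 - u - s) / (s - u))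
  let g : ℝ → ℝ := fun r =>
    2 / Real.pi * (s - r ^ 2) ^ (-(1 / 2) : ℝ) * (r * (r ^ 2 - u) ^ (-(1 / 2) : ℝ))
  have hmem : ∀ r ∈ Ioo √u √s, 0 < r ∧ 0 < s - r ^ 2 ∧ 0 < r ^ 2 - u := by
    intro r hr
    have hr0 : 0 < r := h0u.trans hr.1
    exact ⟨hr0, sub_pos.2 ((Real.lt_sqrt hr0.le).1 hr.2), sub_pos.2 ((Real.sqrt_lt' hr0).1 hr.1)⟩
  have hpi := Real.pi_pos
  have hg0 : ∀ r ∈ Ioo √u √s, 0 ≤ g r := by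
    intro r hr
    obtain ⟨h1, h2, h3⟩ := hmem r hr
    positivity
  have hcont : ContinuousOn G (Icc √u √s) := by fun_prop
  have hderiv : ∀ r ∈ Ioo √u √s, HasDerivAt G (g r) r := by
    intro r hr
    obtain ⟨h1, h2, h3⟩ := hmem r hr
    have hsu : 0 < s - u := sub_pos.2 hus
    set y := (2 * r ^ 2 - u - s) / (s - u) with hy
    have hy1 : 1 - y ^ 2 = 4 * ((s - r ^ 2) * (r ^ 2 - u)) / (s - u) ^ 2 := by
      rw [hy]; field_simp; ring
    have hy2 : 0 < 1 - y ^ 2 := by rw [hy1]; positivity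
    have hd : HasDerivAt (fun r : ℝ => (2 * r ^ 2 - u - s) / (s - u)) (4 * r / (s - u)) r := by
      have := ((((hasDerivAt_pow 2 r).const_mul 2).sub_const u).sub_const s).div_const (s - u)
      refine this.congr_deriv ?_
      norm_num
      ring
    have := ((Real.hasDerivAt_arcsin (x := y) (by nlinarith) (by nlinarith)).comp r hd).const_mul
      (1 / Real.pi)
    refine this.congr_deriv ?_
    have hsq : √(1 - y ^ 2) = 2 * (√(s - r ^ 2) * √(r ^ 2 - u)) / (s - u) := by
      rw [hy1, Real.sqrt_div (by positivity), Real.sqrt_sq hsu.le, Real.sqrt_mul (by norm_num),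
        Real.sqrt_mul h2.le, show (4 : ℝ) = 2 ^ 2 by norm_num, Real.sqrt_sq (by norm_num)]
    simp only [g]
    rw [hsq, Real.rpow_neg h2.le, Real.rpow_neg h3.le, ← Real.sqrt_eq_rpow, ← Real.sqrt_eq_rpow]
    have := Real.sqrt_pos.2 h2
    have := Real.sqrt_pos.2 h3
    field_simp
    ring
  -- The integrand blows up at both ends; integrability comes from its being the nonnegative
  -- derivative of a function continuous up to the ends.
  have hint := intervalIntegral.integrableOn_deriv_of_nonneg hcont hderiv hg0
  have hFTC := intervalIntegral.integral_eq_sub_of_hasDerivAt_of_le hus'.le hcont hderiv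
    ((intervalIntegrable_iff_integrableOn_Ioc_of_le hus'.le).2 hint)
  have hval : G √s - G √u = 1 := by
    have hsu : s - u ≠ 0 := (sub_pos.2 hus).ne'
    simp only [G, Real.sq_sqrt hs.le, Real.sq_sqrt hu.le]
    rw [show (2 * s - u - s) / (s - u) = 1 by field_simp; ring,
      show (2 * u - u - s) / (s - u) = -1 by field_simp; ring, Real.arcsin_one,
      Real.arcsin_neg_one]
    field_simp
    norm_num
  rw [hval, intervalIntegral.integral_of_le hus'.le, integral_Ioc_eq_integral_Ioo] at hFTC
  have hFTC' := congrArg ENNReal.ofReal hFTC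
  rw [ENNReal.ofReal_one] at hFTC'
  rw [← hFTC', ofReal_integral_eq_lintegral_ofReal (hint.mono_set Ioo_subset_Ioc_self)
    ((ae_restrict_iff' measurableSet_Ioo).2 (.of_forall hg0)), ← lintegral_indicator
    measurableSet_Ioi, ← lintegral_indicator measurableSet_Ioo]
  refine lintegral_congr fun r => ?_
  by_cases hr : r ∈ Ioo √u √s
  · obtain ⟨h1, h2, h3⟩ := hmem r hr
    rw [indicator_of_mem (show r ∈ Ioi 0 from h1), indicator_of_mem hr,
      if_pos (sub_pos.1 h3), arcsineDensity, if_pos ⟨h1, hr.2⟩,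
      ← ENNReal.ofReal_mul (by positivity)]
  · rw [indicator_of_notMem hr]
    by_cases h0 : 0 < r
    · rw [indicator_of_mem (show r ∈ Ioi 0 from h0)]
      by_cases h1 : r < √s
      · rw [if_neg, mul_zero]
        exact fun h => hr ⟨(Real.sqrt_lt' h0).2 h, h1⟩
      · rw [arcsineDensity, if_neg fun h => h1 h.2]
        simp
    · exact indicator_of_notMem h0 _

theorem lintegral_arcsineDensity_mul_abel_of_le {u s : ℝ} (hus : s ≤ u) :
    ∫⁻ r in Ioi (0 : ℝ), ENNReal.ofReal (arcsineDensity r s)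
      * (if u < r ^ 2 then ENNReal.ofReal (r * (r ^ 2 - u) ^ (-(1 / 2) : ℝ)) else 0) = 0 := by
  refine (setLIntegral_congr_fun (g := fun _ => 0) measurableSet_Ioi fun r hr => ?_).trans
    lintegral_zero
  have hr0 : (0 : ℝ) < r := hr
  by_cases h : u < r ^ 2
  · have : arcsineDensity r s = 0 := by
      rw [arcsineDensity, if_neg]
      rintro ⟨_, h1⟩
      have := (Real.lt_sqrt hr0.le).1 h1
      linarith
    simp [this]
  · simp [h]

/-- Since directions are preserved, Abel's kernel applied on each ray yields the indicator of `u <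
|x|`. The right side thus depends on `ν` only through its arcsine transform. -/
theorem lintegral_arcsine_abel {d : ℕ} (ν : Measure (EuclideanSpace ℝ (Fin d)))
    {u : ℝ} (hu : 0 < u) {D : Set (EuclideanSpace ℝ (Fin d))} (hD : MeasurableSet D) :
    ∫⁻ y, (if u < ‖y‖ ^ 2 then ENNReal.ofReal (‖y‖ * (‖y‖ ^ 2 - u) ^ (-(1 / 2) : ℝ)) else 0)
      * D.indicator 1 (‖y‖⁻¹ • y) ∂(arcsine ν) = ν {x | u < ‖x‖ ∧ ‖x‖⁻¹ • x ∈ D} := by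
  have h0 : MeasurableSet ({0}ᶜ : Set (EuclideanSpace ℝ (Fin d))) :=
    (measurableSet_singleton 0).compl
  have hA : MeasurableSet {x : EuclideanSpace ℝ (Fin d) | u < ‖x‖ ∧ ‖x‖⁻¹ • x ∈ D} :=
    (measurableSet_lt measurable_const measurable_norm).inter
      ((by fun_prop : Measurable fun x : EuclideanSpace ℝ (Fin d) => ‖x‖⁻¹ • x) hD)
  have hφ : Measurable fun r : ℝ => if u < r ^ 2 then
      ENNReal.ofReal (r * (r ^ 2 - u) ^ (-(1 / 2) : ℝ)) else 0 :=
    Measurable.ite (measurableSet_lt measurable_const (by fun_prop)) (by fun_prop)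
      measurable_const
  have hF : Measurable fun y : EuclideanSpace ℝ (Fin d) =>
      (if u < ‖y‖ ^ 2 then ENNReal.ofReal (‖y‖ * (‖y‖ ^ 2 - u) ^ (-(1 / 2) : ℝ)) else 0)
      * D.indicator (1 : EuclideanSpace ℝ (Fin d) → ℝ≥0∞) (‖y‖⁻¹ • y) :=
    (hφ.comp measurable_norm).mul ((measurable_one.indicator hD).comp (by fun_prop))
  rw [arcsine_eq_rayTransform, lintegral_rayTransform measurable_ofReal_arcsineDensity _ hF,
    ← lintegral_indicator_one hA, ← lintegral_indicator h0]
  refine lintegral_congr fun x => ?_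
  by_cases hx : x = 0
  · subst hx
    simp [hu.le, indicator]
  rw [indicator_of_mem (show x ∈ ({0}ᶜ : Set (EuclideanSpace ℝ (Fin d))) from hx)]
  have h1 : ∀ r ∈ Ioi (0 : ℝ), ENNReal.ofReal (arcsineDensity r ‖x‖) *
      ((if u < ‖r • (‖x‖⁻¹ • x)‖ ^ 2 then ENNReal.ofReal (‖r • (‖x‖⁻¹ • x)‖ *
        (‖r • (‖x‖⁻¹ • x)‖ ^ 2 - u) ^ (-(1 / 2) : ℝ)) else 0)
      * D.indicator (1 : EuclideanSpace ℝ (Fin d) → ℝ≥0∞)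
        (‖r • (‖x‖⁻¹ • x)‖⁻¹ • (r • (‖x‖⁻¹ • x))))
      = ENNReal.ofReal (arcsineDensity r ‖x‖) * (if u < r ^ 2 then
        ENNReal.ofReal (r * (r ^ 2 - u) ^ (-(1 / 2) : ℝ)) else 0) *
        D.indicator (1 : EuclideanSpace ℝ (Fin d) → ℝ≥0∞) (‖x‖⁻¹ • x) := by
    intro r hr
    rw [inv_norm_smul_smul_inv_norm_smul hx hr, norm_smul_inv_norm_smul hx hr, mul_assoc]
  have h2 : Measurable fun r => ENNReal.ofReal (arcsineDensity r ‖x‖) * (if u < r ^ 2 then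
      ENNReal.ofReal (r * (r ^ 2 - u) ^ (-(1 / 2) : ℝ)) else 0) :=
    (measurable_ofReal_arcsineDensity.comp (by fun_prop : Measurable fun r : ℝ => (r, ‖x‖))).mul hφ
  rw [setLIntegral_congr_fun measurableSet_Ioi h1, lintegral_mul_const _ h2]
  rcases lt_or_ge u ‖x‖ with hux | hux
  · rw [lintegral_arcsineDensity_mul_abel hu hux, one_mul]
    by_cases hxD : ‖x‖⁻¹ • x ∈ D <;> simp [indicator, hux, hxD]
  · rw [lintegral_arcsineDensity_mul_abel_of_le hux, zero_mul]
    simp [hux.not_gt]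

theorem IsLevyMeasure.measure_norm_gt_lt_top {d : ℕ} {ν : Measure (EuclideanSpace ℝ (Fin d))}
    (h : IsLevyMeasure ν) {u : ℝ} (hu : 0 < u) : ν {x | u < ‖x‖} < ⊤ := by
  have hpos : 0 < min 1 (u ^ 2) := by positivity
  refine (measure_mono fun x hx => ?_).trans_lt ((meas_ge_le_lintegral_div
    (ε := ENNReal.ofReal (min 1 (u ^ 2))) (by fun_prop)
    (ENNReal.ofReal_pos.2 hpos).ne' ENNReal.ofReal_ne_top).trans_lt
    (ENNReal.div_lt_top h.lintegral_lt_top.ne (ENNReal.ofReal_pos.2 hpos).ne'))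
  have hx' : u < ‖x‖ := hx
  exact ENNReal.ofReal_le_ofReal (min_le_min le_rfl (by gcongr))

/-- In polar coordinates the sets in the hypothesis are half-lines times Borel sets of directions.
The measures may be infinite near the origin, so the comparison is made on `{u < |x|}` and then `u`
decreases to `0`. -/
theorem measure_eq_of_norm_gt {d : ℕ} {ν₁ ν₂ : Measure (EuclideanSpace ℝ (Fin d))}
    (h₁ : ν₁ {0} = 0) (h₂ : ν₂ {0} = 0) (hfin : ∀ u : ℝ, 0 < u → ν₁ {x | u < ‖x‖} < ⊤)
    (h : ∀ u : ℝ, 0 < u → ∀ D : Set (EuclideanSpace ℝ (Fin d)), MeasurableSet D →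
      ν₁ {x | u < ‖x‖ ∧ ‖x‖⁻¹ • x ∈ D} = ν₂ {x | u < ‖x‖ ∧ ‖x‖⁻¹ • x ∈ D}) : ν₁ = ν₂ := by
  let f : EuclideanSpace ℝ (Fin d) → ℝ × EuclideanSpace ℝ (Fin d) := fun x => (‖x‖, ‖x‖⁻¹ • x)
  let g : ℝ × EuclideanSpace ℝ (Fin d) → EuclideanSpace ℝ (Fin d) := fun p => p.1 • p.2
  have hf : Measurable f := by fun_prop
  have hg : Measurable g := by fun_prop
  have hgf : g ∘ f = id := by
    funext x
    by_cases hx : x = 0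
    · simp [f, g, hx]
    · simp [f, g, smul_smul, hx]
  have hu : ∀ u : ℝ, 0 < u → ν₁.restrict {x | u < ‖x‖} = ν₂.restrict {x | u < ‖x‖} := by
    intro u hu
    have hms : MeasurableSet {x : EuclideanSpace ℝ (Fin d) | u < ‖x‖} :=
      measurableSet_lt measurable_const measurable_norm
    have hF1 : IsFiniteMeasure (ν₁.restrict {x | u < ‖x‖}) :=
      ⟨by simpa using hfin u hu⟩
    have hval : ∀ ν : Measure (EuclideanSpace ℝ (Fin d)), ∀ v, ∀ D, MeasurableSet D →
        (ν.restrict {x | u < ‖x‖}).map f (Ioi v ×ˢ D)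
          = ν {x | max u v < ‖x‖ ∧ ‖x‖⁻¹ • x ∈ D} := by
      intro ν v D hD
      rw [Measure.map_apply hf (measurableSet_Ioi.prod hD), Measure.restrict_apply
        (hf (measurableSet_Ioi.prod hD))]
      congr 1
      ext x
      simp only [mem_inter_iff, mem_preimage, f, mem_prod, mem_Ioi, mem_ofPred_eq, max_lt_iff]
      tauto
    have hmap : (ν₁.restrict {x | u < ‖x‖}).map f = (ν₂.restrict {x | u < ‖x‖}).map f := by
      refine Measure.ext_prod fun {s D} hs hD => ?_
      have key : ∀ ν : Measure (EuclideanSpace ℝ (Fin d)), (ν.restrict {x | u < ‖x‖}).map f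
          (s ×ˢ D) = (((ν.restrict {x | u < ‖x‖}).map f).restrict (univ ×ˢ D)).map Prod.fst s := by
        intro ν
        rw [Measure.map_apply measurable_fst hs, Measure.restrict_apply (measurable_fst hs)]
        congr 1
        ext p
        simp
      rw [key ν₁, key ν₂]
      congr 1
      have hI : ∀ ν : Measure (EuclideanSpace ℝ (Fin d)), ∀ v,
          (((ν.restrict {x | u < ‖x‖}).map f).restrict (univ ×ˢ D)).map Prod.fst (Ioi v)
            = ν {x | max u v < ‖x‖ ∧ ‖x‖⁻¹ • x ∈ D} := by
        intro ν v
        rw [← hval ν v D hD, Measure.map_apply measurable_fst measurableSet_Ioi,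
          Measure.restrict_apply (measurable_fst measurableSet_Ioi)]
        congr 1
        ext p
        simp
      have hU : ∀ ν : Measure (EuclideanSpace ℝ (Fin d)),
          (((ν.restrict {x | u < ‖x‖}).map f).restrict (univ ×ˢ D)).map Prod.fst univ
            = ν {x | u < ‖x‖ ∧ ‖x‖⁻¹ • x ∈ D} := by
        intro ν
        have h3 := hval ν u D hD
        rw [max_self] at h3
        rw [← h3, Measure.map_apply measurable_fst MeasurableSet.univ, preimage_univ,
          Measure.restrict_apply_univ, Measure.map_apply hf (MeasurableSet.univ.prod hD),
          Measure.map_apply hf (measurableSet_Ioi.prod hD),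
          Measure.restrict_apply (hf (MeasurableSet.univ.prod hD)),
          Measure.restrict_apply (hf (measurableSet_Ioi.prod hD))]
        congr 1
        ext x
        simp [f, and_comm]
      have hEq := fun v => (hI ν₁ v).trans ((h _ (lt_max_of_lt_left hu) D hD).trans (hI ν₂ v).symm)
      have hEqU := (hU ν₁).trans ((h _ hu D hD).trans (hU ν₂).symm)
      have hfin2 : ∀ v, (((ν₂.restrict {x | u < ‖x‖}).map f).restrict (univ ×ˢ D)).map
          Prod.fst (Ioi v) ≠ ⊤ := fun v => by rw [← hEq v]; exact measure_ne_top _ _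
      refine Measure.ext_of_Iic _ _ fun v => ?_
      rw [← compl_Ioi, measure_compl measurableSet_Ioi (measure_ne_top _ _),
        measure_compl measurableSet_Ioi (hfin2 v), hEq v, hEqU]
    have := congrArg (Measure.map g) hmap
    rwa [Measure.map_map hg hf, Measure.map_map hg hf, hgf, Measure.map_id, Measure.map_id] at this
  -- The origin is adjoined so that the sets cover the whole space; it is a null set for both
  -- measures.
  let s : ℕ → Set (EuclideanSpace ℝ (Fin d)) := fun n =>
    {x | x = 0 ∨ 1 / ((n : ℝ) + 1) < ‖x‖}
  have hs : ⋃ n, s n = univ := by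
    refine eq_univ_of_forall fun x => mem_iUnion.2 ?_
    rcases eq_or_ne x 0 with rfl | hx
    · exact ⟨0, Or.inl rfl⟩
    · obtain ⟨n, hn⟩ := exists_nat_one_div_lt (norm_pos_iff.2 hx)
      exact ⟨n, Or.inr hn⟩
  have hr : ∀ ν : Measure (EuclideanSpace ℝ (Fin d)), ν {0} = 0 → ∀ n,
      ν.restrict (s n) = ν.restrict {x | 1 / ((n : ℝ) + 1) < ‖x‖} := by
    intro ν hν n
    refine Measure.restrict_congr_set ?_
    have : ∀ᵐ x ∂ν, x ≠ 0 := by simpa [ae_iff] using hν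
    filter_upwards [this] with x hx
    exact propext ⟨fun h => h.resolve_left hx, Or.inr⟩
  refine (Measure.ext_iff_of_iUnion_eq_univ hs).2 fun n => ?_
  rw [hr ν₁ h₁, hr ν₂ h₂, hu _ Nat.one_div_pos_of_nat]

/-- The arcsine transformation is injective on Lévy measures. -/
theorem arcsine_injective {d : ℕ} {ν₁ ν₂ : Measure (EuclideanSpace ℝ (Fin d))}
    (h₁ : IsLevyMeasure ν₁) (h₂ : IsLevyMeasure ν₂) (h : arcsine ν₁ = arcsine ν₂) : ν₁ = ν₂ := by
  refine measure_eq_of_norm_gt h₁.zero h₂.zero (fun u hu => h₁.measure_norm_gt_lt_top hu)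
    fun u hu D hD => ?_
  rw [← lintegral_arcsine_abel ν₁ hu hD, ← lintegral_arcsine_abel ν₂ hu hD, h]

/-! ### The transformation `Υ⁰` -/

theorem isLevyMeasureOne_of_lintegral {d : ℕ} {ν : Measure (EuclideanSpace ℝ (Fin d))}
    (h0 : ν {0} = 0) (h : ∫⁻ x, ENNReal.ofReal (min 1 ‖x‖) ∂ν < ⊤) : IsLevyMeasureOne ν := by
  refine ⟨⟨h0, lt_of_le_of_lt (lintegral_mono fun x => ENNReal.ofReal_le_ofReal ?_) h⟩, h⟩
  have := norm_nonneg x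
  rcases le_total ‖x‖ 1 with hx | hx
  · rw [min_eq_right hx]
    exact (min_le_right _ _).trans (by nlinarith)
  · rw [min_eq_left hx]
    exact min_le_left _ _

theorem lintegral_exp_neg_Ioi (c : ℝ) :
    ∫⁻ u in Ioi c, ENNReal.ofReal (Real.exp (-u)) = ENNReal.ofReal (Real.exp (-c)) := by
  rw [← integral_exp_neg_Ioi c, ofReal_integral_eq_lintegral_ofReal]
  · have : IntegrableOn (fun u : ℝ => Real.exp (-u)) (Ioi c) := by
      simpa using exp_neg_integrableOn_Ioi c one_pos
    exact this
  · exact .of_forall fun u => (Real.exp_pos _).le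

/-- Integrate `min 1 (u |x|) ≤ (1 + u) min 1 |x|` against `e^{-u} du`. -/
theorem IsLevyMeasureOne.upsilonZero {d : ℕ} {ρ : Measure (EuclideanSpace ℝ (Fin d))}
    (h : IsLevyMeasureOne ρ) : IsLevyMeasureOne (upsilonZero ρ) := by
  have := h.isLevyMeasure.sigmaFinite
  refine isLevyMeasureOne_of_lintegral ?_ ?_
  · rw [upsilonZero_eq_rayTransform ρ h.isLevyMeasure.zero]
    exact rayTransform_zero_singleton (measurable_inv_mul_expKernel 1) ρ
  have hC : ∫⁻ u in Ioi (0 : ℝ), ENNReal.ofReal (Real.exp (-u)) * ENNReal.ofReal (1 + u) < ⊤ := by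
    -- From `1 + u ≤ 2 e^{u/2}` one gets `e^{-u} (1 + u) ≤ 2 e^{-u/2}`.
    refine (setLIntegral_mono (g := fun u => ENNReal.ofReal (4 * (Real.exp (-(u / 2)) * (1 / 2))))
      (by fun_prop) fun u hu => ?_).trans_lt ?_
    · rw [← ENNReal.ofReal_mul (Real.exp_pos _).le]
      refine ENNReal.ofReal_le_ofReal ?_
      have h1 := Real.add_one_le_exp (u / 2)
      have h2 : Real.exp (-u) = Real.exp (-(u / 2)) * Real.exp (-(u / 2)) := by
        rw [← Real.exp_add]; ring_nf
      have h3 : Real.exp (-(u / 2)) * Real.exp (u / 2) = 1 := by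
        rw [← Real.exp_add]; simp
      have h4 := Real.exp_pos (-(u / 2))
      rw [h2]
      have h5 : 1 + u ≤ 2 * Real.exp (u / 2) := by linarith
      have h6 := mul_le_mul_of_nonneg_left h5 (mul_pos h4 h4).le
      nlinarith
    · have hi : IntegrableOn (fun u : ℝ => 4 * (Real.exp (-(u / 2)) * (1 / 2))) (Ioi 0) := by
        refine (Integrable.mul_const ?_ _).const_mul _
        have := exp_neg_integrableOn_Ioi 0 (by norm_num : (0 : ℝ) < 1 / 2)
        refine this.congr (.of_forall fun u => ?_)
        simp only
        ring_nf
      exact hi.lintegral_lt_top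
  rw [lintegral_upsilonZero ρ (by fun_prop)]
  refine lt_of_le_of_lt (lintegral_mono (g := fun x => ENNReal.ofReal (min 1 ‖x‖) *
    ∫⁻ u in Ioi (0 : ℝ), ENNReal.ofReal (Real.exp (-u)) * ENNReal.ofReal (1 + u)) fun x => ?_) ?_
  · simp only
    rw [← lintegral_const_mul _ (by fun_prop)]
    refine setLIntegral_mono (by fun_prop) fun u hu => ?_
    have hu0 : (0 : ℝ) < u := hu
    rw [mul_left_comm]
    gcongr
    rw [← ENNReal.ofReal_mul (by positivity)]
    refine ENNReal.ofReal_le_ofReal ?_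
    rw [norm_smul, Real.norm_of_nonneg hu0.le]
    have := norm_nonneg x
    rcases min_cases 1 ‖x‖ with ⟨hm, _⟩ | ⟨hm, _⟩ <;> rw [hm]
    · exact (min_le_left _ _).trans (by linarith)
    · exact (min_le_right _ _).trans (by nlinarith)
  · rw [lintegral_mul_const _ (by fun_prop)]
    exact ENNReal.mul_lt_top h.lintegral_lt_top hC

/-- The point `u x` lies beyond radius `s` exactly when `u > s / |x|`, an event of exponential
probability `exp (-s / |x|)`. -/
theorem upsilonZero_apply_norm_gt {d : ℕ} (ρ : Measure (EuclideanSpace ℝ (Fin d))) [SFinite ρ]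
    (h0 : ρ {0} = 0) {s : ℝ} (hs : 0 < s) {D : Set (EuclideanSpace ℝ (Fin d))}
    (hD : MeasurableSet D) : upsilonZero ρ {x | s < ‖x‖ ∧ ‖x‖⁻¹ • x ∈ D}
      = ∫⁻ x, ENNReal.ofReal (Real.exp (-(s / ‖x‖))) * D.indicator 1 (‖x‖⁻¹ • x) ∂ρ := by
  have hA : MeasurableSet {x : EuclideanSpace ℝ (Fin d) | s < ‖x‖ ∧ ‖x‖⁻¹ • x ∈ D} :=
    (measurableSet_lt measurable_const measurable_norm).inter
      ((by fun_prop : Measurable fun x : EuclideanSpace ℝ (Fin d) => ‖x‖⁻¹ • x) hD)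
  rw [← lintegral_indicator_one hA, lintegral_upsilonZero ρ (measurable_one.indicator hA)]
  have hne : ∀ᵐ x ∂ρ, x ≠ 0 := by simpa [ae_iff] using h0
  refine lintegral_congr_ae ?_
  filter_upwards [hne] with x hx
  have hx0 : 0 < ‖x‖ := norm_pos_iff.2 hx
  rw [← lintegral_exp_neg_Ioi, ← lintegral_mul_const _ (by fun_prop),
    ← lintegral_indicator measurableSet_Ioi, ← lintegral_indicator measurableSet_Ioi]
  refine lintegral_congr fun u => ?_
  by_cases hu : 0 < u
  · rw [indicator_of_mem (show u ∈ Ioi 0 from hu)]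
    have h1 : ‖u • x‖ = u * ‖x‖ := by rw [norm_smul, Real.norm_of_nonneg hu.le]
    have h2 : ‖u • x‖⁻¹ • (u • x) = ‖x‖⁻¹ • x := by
      rw [h1, smul_smul]; congr 1; field_simp
    have h3 : s < u * ‖x‖ ↔ s / ‖x‖ < u := (div_lt_iff₀ hx0).symm
    have hmem : u • x ∈ {x : EuclideanSpace ℝ (Fin d) | s < ‖x‖ ∧ ‖x‖⁻¹ • x ∈ D} ↔
        u ∈ Ioi (s / ‖x‖) ∧ ‖x‖⁻¹ • x ∈ D := by
      rw [mem_ofPred_eq, h2, h1, h3, mem_Ioi]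
    by_cases h4 : u ∈ Ioi (s / ‖x‖) <;> by_cases h5 : ‖x‖⁻¹ • x ∈ D <;>
      simp only [indicator, hmem, h4, h5, and_true, and_false, and_self, if_true, if_false,
        Pi.one_apply, mul_one, mul_zero]
  · rw [indicator_of_notMem (show u ∉ Ioi 0 from hu), indicator_of_notMem]
    exact fun h => hu (lt_trans (by positivity) (mem_Ioi.1 h))

/-- `Υ⁰` is injective. -/
theorem upsilonZero_injective {d : ℕ} {ρ₁ ρ₂ : Measure (EuclideanSpace ℝ (Fin d))}
    (h₁ : IsLevyMeasureOne ρ₁) (h₂ : IsLevyMeasureOne ρ₂)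
    (h : upsilonZero ρ₁ = upsilonZero ρ₂) : ρ₁ = ρ₂ := by
  let c : EuclideanSpace ℝ (Fin d) → ℝ≥0∞ := fun x => ENNReal.ofReal (Real.exp (-(1 / ‖x‖)))
  -- Polar coordinates with the radius replaced by `w = exp (-1 / |x|)`; `g` undoes this, also at
  -- the origin, where the direction is `0`.
  let f : EuclideanSpace ℝ (Fin d) → Icc (0 : ℝ) 1 × EuclideanSpace ℝ (Fin d) := fun x =>
    (⟨Real.exp (-(1 / ‖x‖)), (Real.exp_pos _).le, Real.exp_le_one_iff.2 (by simp)⟩, ‖x‖⁻¹ • x)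
  let g : Icc (0 : ℝ) 1 × EuclideanSpace ℝ (Fin d) → EuclideanSpace ℝ (Fin d) := fun p =>
    (-Real.log p.1)⁻¹ • p.2
  have hc : Measurable c := by fun_prop
  have hf : Measurable f := by
    refine Measurable.prodMk (Measurable.subtype_mk (by fun_prop)) (by fun_prop)
  have hg : Measurable g := by
    refine Measurable.smul (Measurable.inv (Measurable.neg (Real.measurable_log.comp ?_)))
      measurable_snd
    exact measurable_subtype_coe.comp measurable_fst
  have hgf : g ∘ f = id := by
    funext x
    by_cases hx : x = 0
    · simp [f, g, hx]
    · simp [f, g, smul_smul, hx]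
  -- One factor `w` of `exp (-(k + 1) / |x|) = w · w ^ k` is the weight `c`, and the other is the
  -- `k`-th moment. The case `k = 0` shows that the weighted measure is finite.
  have key : ∀ ρ : Measure (EuclideanSpace ℝ (Fin d)), IsLevyMeasureOne ρ →
      ∀ D, MeasurableSet D → ∀ k : ℕ, ∫⁻ w, ENNReal.ofReal ((w : ℝ) ^ k)
        ∂((((ρ.withDensity c).map f).restrict (univ ×ˢ D)).map Prod.fst)
        = upsilonZero ρ {x | (k + 1 : ℝ) < ‖x‖ ∧ ‖x‖⁻¹ • x ∈ D} := by
    intro ρ hρ D hD k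
    have := hρ.isLevyMeasure.sigmaFinite
    have hUD : MeasurableSet ((univ : Set (Icc (0 : ℝ) 1)) ×ˢ D) := MeasurableSet.univ.prod hD
    have hk : Measurable fun w : Icc (0 : ℝ) 1 => ENNReal.ofReal ((w : ℝ) ^ k) := by fun_prop
    let G : Icc (0 : ℝ) 1 × EuclideanSpace ℝ (Fin d) → ℝ≥0∞ :=
      ((univ : Set (Icc (0 : ℝ) 1)) ×ˢ D).indicator fun p => ENNReal.ofReal ((p.1 : ℝ) ^ k)
    have hG : Measurable G := (hk.comp measurable_fst).indicator hUD
    rw [upsilonZero_apply_norm_gt ρ hρ.isLevyMeasure.zero (by positivity) hD,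
      lintegral_map hk measurable_fst, ← lintegral_indicator hUD, lintegral_map hG hf,
      lintegral_withDensity_eq_lintegral_mul _ hc (g := fun x => G (f x)) (hG.comp hf)]
    refine lintegral_congr fun x => ?_
    by_cases hx : ‖x‖⁻¹ • x ∈ D
    · have h1 : f x ∈ (univ : Set (Icc (0 : ℝ) 1)) ×ˢ D := ⟨trivial, hx⟩
      rw [Pi.mul_apply, indicator_of_mem hx]
      simp only [G, indicator_of_mem h1, c, f, Pi.one_apply, mul_one]
      rw [← ENNReal.ofReal_mul (Real.exp_pos _).le, ← Real.exp_nat_mul, ← Real.exp_add]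
      congr 2
      ring
    · have h1 : f x ∉ (univ : Set (Icc (0 : ℝ) 1)) ×ˢ D := fun h => hx h.2
      rw [Pi.mul_apply, indicator_of_notMem hx]
      simp only [G, indicator_of_notMem h1, mul_zero]
  have hfin : ∀ ρ : Measure (EuclideanSpace ℝ (Fin d)), IsLevyMeasureOne ρ →
      IsFiniteMeasure ((ρ.withDensity c).map f) := by
    intro ρ hρ
    have h1 := key ρ hρ univ MeasurableSet.univ 0
    simp only [univ_prod_univ, Measure.restrict_univ, pow_zero, ENNReal.ofReal_one,
      lintegral_one] at h1
    rw [Measure.map_apply measurable_fst MeasurableSet.univ, preimage_univ] at h1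
    refine ⟨h1 ▸ ?_⟩
    refine (measure_mono fun x hx => ?_).trans_lt
      (hρ.upsilonZero.isLevyMeasure.measure_norm_gt_lt_top one_pos)
    simpa using hx.1
  have := hfin ρ₁ h₁
  have := hfin ρ₂ h₂
  have hmap : (ρ₁.withDensity c).map f = (ρ₂.withDensity c).map f := by
    refine Measure.ext_prod fun {s D} hs hD => ?_
    have hval : ∀ ρ : Measure (EuclideanSpace ℝ (Fin d)), (ρ.withDensity c).map f (s ×ˢ D)
        = (((ρ.withDensity c).map f).restrict (univ ×ˢ D)).map Prod.fst s := by
      intro ρ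
      rw [Measure.map_apply measurable_fst hs, Measure.restrict_apply (measurable_fst hs)]
      congr 1
      ext p
      simp
    rw [hval ρ₁, hval ρ₂]
    congr 1
    refine ext_of_moments fun k => ?_
    rw [integral_eq_lintegral_of_nonneg_ae (.of_forall fun w => pow_nonneg w.2.1 k)
      (by fun_prop), integral_eq_lintegral_of_nonneg_ae (.of_forall fun w => pow_nonneg w.2.1 k)
      (by fun_prop), key ρ₁ h₁ D hD k, key ρ₂ h₂ D hD k, h]
  have hwd : ρ₁.withDensity c = ρ₂.withDensity c := by
    have := congrArg (Measure.map g) hmap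
    rwa [Measure.map_map hg hf, Measure.map_map hg hf, hgf, Measure.map_id, Measure.map_id] at this
  have hinv : ∀ ρ : Measure (EuclideanSpace ℝ (Fin d)),
      (ρ.withDensity c).withDensity (fun x => (c x)⁻¹) = ρ := fun ρ =>
    withDensity_inv_same hc (.of_forall fun x => (ENNReal.ofReal_pos.2 (Real.exp_pos _)).ne')
      (.of_forall fun x => ENNReal.ofReal_ne_top)
  rw [← hinv ρ₁, hwd, hinv ρ₂]

/-! ### The Hausdorff moment problem -/

/-- The linear functional on polynomials with moments `m`. -/
def momentFunctional (m : ℕ → ℝ) : Polynomial ℝ →ₗ[ℝ] ℝ :=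
  (Polynomial.basisMonomials ℝ).constr ℝ m

theorem momentFunctional_X_pow (m : ℕ → ℝ) (k : ℕ) :
    momentFunctional m (Polynomial.X ^ k) = m k := by
  rw [← Polynomial.monomial_one_right_eq_X_pow]
  exact (Polynomial.basisMonomials ℝ).constr_basis ℝ m k

/-- Multiplication by `1 - X` corresponds to differencing the moment sequence, which permits
induction on the power of `1 - X`. -/
theorem momentFunctional_mul_one_sub_X (m : ℕ → ℝ) (p : Polynomial ℝ) :
    momentFunctional m (p * (1 - Polynomial.X))
      = momentFunctional (fun k => m k - m (k + 1)) p := by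
  induction p using Polynomial.induction_on' with
  | add p q hp hq => rw [add_mul, map_add, map_add, hp, hq]
  | monomial n a =>
    rw [← Polynomial.C_mul_X_pow_eq_monomial, ← Polynomial.smul_eq_C_mul, smul_mul_assoc,
      map_smul, map_smul, mul_sub, mul_one, ← pow_succ, map_sub]
    simp only [momentFunctional_X_pow]

/-- Passing from `j` to `j + 1` multiplies the ratio by `(i - j) / (n - j)` (truncated at `0`),
which is within `j / (n - j)` of `i / n`, uniformly in `i ≤ n`. -/
theorem abs_choose_ratio_sub_pow_le (j : ℕ) {ε : ℝ} (hε : 0 < ε) :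
    ∀ᶠ n : ℕ in atTop, ∀ i ≤ n,
      0 ≤ (i.choose j : ℝ) / n.choose j ∧ (i.choose j : ℝ) / n.choose j ≤ 1 ∧
        |(i.choose j : ℝ) / n.choose j - ((i : ℝ) / n) ^ j| ≤ ε := by
  induction j generalizing ε with
  | zero => exact .of_forall fun n i _ => by simp [hε.le]
  | succ j ih =>
    have hlim : Tendsto (fun n : ℕ => (j : ℝ) / ((n : ℝ) - j)) atTop (𝓝 0) :=
      Tendsto.const_div_atTop (tendsto_atTop_add_const_right _ _ tendsto_natCast_atTop_atTop) _
    filter_upwards [ih (half_pos hε), hlim.eventually_lt_const (half_pos hε),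
      eventually_gt_atTop j] with n h1 h2 hn i hi
    obtain ⟨h3, h4, h5⟩ := h1 i hi
    have hnj : (0 : ℝ) < (n : ℝ) - j := sub_pos.2 (by exact_mod_cast hn)
    have hn0 : (0 : ℝ) < n := by exact_mod_cast (Nat.zero_le j).trans_lt hn
    set t : ℝ := ((i - j : ℕ) : ℝ) / ((n - j : ℕ) : ℝ) with ht
    have hR : (i.choose (j + 1) : ℝ) / n.choose (j + 1) = (i.choose j : ℝ) / n.choose j * t := by
      have e1 : (i.choose (j + 1) : ℝ) * (j + 1) = i.choose j * (i - j : ℕ) := by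
        exact_mod_cast Nat.choose_succ_right_eq i j
      have e2 : (n.choose (j + 1) : ℝ) * (j + 1) = n.choose j * (n - j : ℕ) := by
        exact_mod_cast Nat.choose_succ_right_eq n j
      rw [ht, div_mul_div_comm, ← e1, ← e2, mul_div_mul_right _ _ (by positivity)]
    have ht0 : 0 ≤ t := by positivity
    have ht1 : t ≤ 1 := div_le_one_of_le₀ (by exact_mod_cast Nat.sub_le_sub_right hi j)
      (Nat.cast_nonneg _)
    have hin : (i : ℝ) ≤ n := by exact_mod_cast hi
    have hx0 : (0 : ℝ) ≤ (i : ℝ) / n := by positivity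
    have hx1 : (i : ℝ) / n ≤ 1 := div_le_one_of_le₀ hin hn0.le
    have hj0 : (0 : ℝ) ≤ j := j.cast_nonneg
    have htx : |t - (i : ℝ) / n| ≤ j / ((n : ℝ) - j) := by
      rw [ht, Nat.cast_sub hn.le]
      rcases le_total j i with hji | hij
      · rw [Nat.cast_sub hji, abs_sub_comm]
        have : (i : ℝ) / n - ((i : ℝ) - j) / (n - j) = j / (n - j) * (((n : ℝ) - i) / n) := by
          field_simp; ring
        rw [this, abs_of_nonneg (by have := sub_nonneg.2 hin; positivity)]
        refine mul_le_of_le_one_right (by positivity) (div_le_one_of_le₀ ?_ hn0.le)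
        linarith [(i.cast_nonneg : (0 : ℝ) ≤ i)]
      · rw [Nat.sub_eq_zero_of_le hij, Nat.cast_zero, zero_div, zero_sub, abs_neg,
          abs_of_nonneg hx0]
        have hij' : (i : ℝ) ≤ j := by exact_mod_cast hij
        gcongr
        linarith
    refine ⟨by rw [hR]; positivity, by rw [hR]; exact mul_le_one₀ h4 ht0 ht1, ?_⟩
    rw [hR, pow_succ]
    set R := (i.choose j : ℝ) / n.choose j
    set x := (i : ℝ) / n
    have hxj : x ^ j ≤ 1 := pow_le_one₀ hx0 hx1
    have hxj0 : 0 ≤ x ^ j := pow_nonneg hx0 j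
    calc |R * t - x ^ j * x| = |(R - x ^ j) * t + x ^ j * (t - x)| := by ring_nf
      _ ≤ |R - x ^ j| * t + x ^ j * |t - x| := by
        refine (abs_add_le _ _).trans (le_of_eq ?_)
        rw [abs_mul, abs_mul, abs_of_nonneg ht0, abs_of_nonneg hxj0]
      _ ≤ |R - x ^ j| * 1 + 1 * |t - x| := by gcongr
      _ ≤ ε := by linarith

/-- Expand `X ^ j = X ^ j (X + (1 - X)) ^ (n - j)` and use `C(n, j + l) C(j + l, j) = C(n, j) C(n -
j, l)`. The terms with `i < j` vanish. -/
theorem sum_choose_mul_momentFunctional (m : ℕ → ℝ) {n j : ℕ} (hj : j ≤ n) :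
    ∑ i ∈ Finset.range (n + 1), (n.choose i : ℝ)
      * momentFunctional m (Polynomial.X ^ i * (1 - Polynomial.X) ^ (n - i))
      * ((i.choose j : ℝ) / n.choose j) = m j := by
  have h0 : (n.choose j : ℝ) ≠ 0 := by exact_mod_cast (Nat.choose_pos hj).ne'
  have h1 : (Polynomial.X ^ j : Polynomial ℝ) = ∑ l ∈ Finset.range (n - j + 1),
      ((n - j).choose l : ℝ) • (Polynomial.X ^ (j + l) * (1 - Polynomial.X) ^ (n - (j + l))) := by
    have := add_pow (Polynomial.X : Polynomial ℝ) (1 - Polynomial.X) (n - j)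
    rw [add_sub_cancel, one_pow] at this
    calc (Polynomial.X ^ j : Polynomial ℝ) = Polynomial.X ^ j * 1 := (mul_one _).symm
      _ = _ := by
        conv_lhs => rw [this, Finset.mul_sum]
        refine Finset.sum_congr rfl fun l _ => ?_
        rw [Polynomial.smul_eq_C_mul, Polynomial.C_eq_natCast, Nat.sub_sub, pow_add]
        ring
  have h2 : n + 1 = j + (n - j + 1) := by omega
  rw [← momentFunctional_X_pow m j, h1, map_sum, h2, Finset.sum_range_add,
    Finset.sum_eq_zero fun i hi => ?_, zero_add]
  · refine Finset.sum_congr rfl fun l hl => ?_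
    have hl' : j + l ≤ n := by have := Finset.mem_range.1 hl; omega
    have h3 : (n.choose (j + l) : ℝ) * (j + l).choose j = n.choose j * (n - j).choose l := by
      have := Nat.choose_mul (n := n) (k := j + l) (s := j) (Nat.le_add_right j l)
      rw [Nat.add_sub_cancel_left] at this
      exact_mod_cast this
    rw [map_smul, smul_eq_mul, mul_right_comm, mul_div_assoc', h3, mul_div_cancel_left₀ _ h0]
  · rw [Nat.choose_eq_zero_of_lt (Finset.mem_range.1 hi)]
    simp

/-- Hausdorff's theorem. The Bernstein weights `a n i` placed at the points `i / n` form measures of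
constant mass `m 0`, hence with a weak limit point by compactness. Their exact factorial moments
equal `m j`, and the ordinary moments differ from these by a vanishing amount. -/
theorem exists_measure_of_moments {m : ℕ → ℝ} (hm : ∀ i k,
    0 ≤ momentFunctional m (Polynomial.X ^ k * (1 - Polynomial.X) ^ i)) :
    ∃ P : Measure (Icc (0 : ℝ) 1), IsFiniteMeasure P ∧ ∀ j : ℕ, ∫ x, (x : ℝ) ^ j ∂P = m j := by
  let a : ℕ → ℕ → ℝ := fun n i => (n.choose i : ℝ)
    * momentFunctional m (Polynomial.X ^ i * (1 - Polynomial.X) ^ (n - i))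
  have ha : ∀ n i, 0 ≤ a n i := fun n i => mul_nonneg (Nat.cast_nonneg _) (hm _ _)
  let pt : ℕ → ℕ → Icc (0 : ℝ) 1 := fun n i => projIcc 0 1 zero_le_one ((i : ℝ) / n)
  have hpt : ∀ n i, i ≤ n → ((pt n i : Icc (0 : ℝ) 1) : ℝ) = (i : ℝ) / n := by
    intro n i hi
    have : (i : ℝ) / n ∈ Icc (0 : ℝ) 1 :=
      ⟨by positivity, div_le_one_of_le₀ (by exact_mod_cast hi) (Nat.cast_nonneg _)⟩
    simp only [pt]
    rw [projIcc_of_mem _ this]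
  let Q : ℕ → Measure (Icc (0 : ℝ) 1) := fun n =>
    ∑ i ∈ Finset.range (n + 1), ENNReal.ofReal (a n i) • Measure.dirac (pt n i)
  have hQint : ∀ n (f : Icc (0 : ℝ) 1 → ℝ), Measurable f →
      ∫ x, f x ∂(Q n) = ∑ i ∈ Finset.range (n + 1), a n i * f (pt n i) := by
    intro n f hf
    simp only [Q]
    rw [integral_finsetSum_measure]
    · refine Finset.sum_congr rfl fun i _ => ?_
      rw [integral_smul_measure, integral_dirac, ENNReal.toReal_ofReal (ha n i), smul_eq_mul]
    · intro i _
      exact (integrable_dirac (by simp)).smul_measure ENNReal.ofReal_ne_top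
  have hsum : ∀ n, ∑ i ∈ Finset.range (n + 1), a n i = m 0 := by
    intro n
    have := sum_choose_mul_momentFunctional m (Nat.zero_le n)
    simpa [a] using this
  have hm0 : 0 ≤ m 0 := by rw [← hsum 0]; exact Finset.sum_nonneg fun i _ => ha 0 i
  have hQuniv : ∀ n, Q n univ = ENNReal.ofReal (m 0) := by
    intro n
    simp only [Q, Measure.finsetSum_apply, Measure.smul_apply, measure_univ, smul_eq_mul, mul_one]
    rw [← ENNReal.ofReal_sum_of_nonneg fun i _ => ha n i, hsum]
  let R : ℕ → FiniteMeasure (Icc (0 : ℝ) 1) := fun n =>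
    ⟨Q n, ⟨by rw [hQuniv]; exact ENNReal.ofReal_lt_top⟩⟩
  have hmass : ∀ n, (R n).mass = (m 0).toNNReal := by
    intro n
    rw [← ENNReal.coe_inj, FiniteMeasure.ennreal_mass]
    exact hQuniv n
  have hK := isCompact_setOfPred_finiteMeasure_eq_of_compactSpace (Icc (0 : ℝ) 1) (m 0).toNNReal
  -- An ultrafilter limit takes the place of a convergent subsequence.
  have hle : ((hyperfilter ℕ : Ultrafilter ℕ) : Filter ℕ) ≤ atTop := by
    rw [← Nat.cofinite_eq_atTop]; exact hyperfilter_le_cofinite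
  obtain ⟨P, -, hP⟩ := isCompact_iff_ultrafilter_le_nhds'.1 hK ((hyperfilter ℕ).map R)
    (Filter.Eventually.of_forall hmass : ∀ᶠ n in (hyperfilter ℕ : Filter ℕ), _)
  refine ⟨P, inferInstance, fun j => ?_⟩
  let F : BoundedContinuousFunction (Icc (0 : ℝ) 1) ℝ :=
    BoundedContinuousFunction.mkOfCompact ⟨fun x => (x : ℝ) ^ j, by fun_prop⟩
  have h1 := FiniteMeasure.tendsto_iff_forall_integral_tendsto.1
    (hP : Tendsto R (hyperfilter ℕ) (𝓝 P)) F
  have h2 : Tendsto (fun n => ∫ x, F x ∂(R n : Measure (Icc (0 : ℝ) 1))) atTop (𝓝 (m j)) := by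
    rw [Metric.tendsto_nhds]
    intro ε hε
    have hε' : 0 < ε / (m 0 + 1) := by positivity
    filter_upwards [abs_choose_ratio_sub_pow_le j hε', eventually_ge_atTop j] with n hn hjn
    have e1 : ∫ x, F x ∂(R n : Measure (Icc (0 : ℝ) 1))
        = ∑ i ∈ Finset.range (n + 1), a n i * ((i : ℝ) / n) ^ j := by
      refine (hQint n F F.continuous.measurable).trans (Finset.sum_congr rfl fun i hi => ?_)
      have := hpt n i (Nat.lt_succ_iff.1 (Finset.mem_range.1 hi))
      rw [← this]
      rfl
    rw [Real.dist_eq, e1, ← sum_choose_mul_momentFunctional m hjn, ← Finset.sum_sub_distrib]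
    refine (Finset.abs_sum_le_sum_abs _ _).trans_lt ?_
    calc _ ≤ ∑ i ∈ Finset.range (n + 1), a n i * (ε / (m 0 + 1)) := by
          refine Finset.sum_le_sum fun i hi => ?_
          have := (hn i (Nat.lt_succ_iff.1 (Finset.mem_range.1 hi))).2.2
          rw [← mul_sub, abs_mul, abs_of_nonneg (ha n i), abs_sub_comm]
          exact mul_le_mul_of_nonneg_left this (ha n i)
      _ = m 0 * (ε / (m 0 + 1)) := by rw [← Finset.sum_mul, hsum]
      _ < ε := by
        rw [mul_div_assoc', div_lt_iff₀ (by positivity)]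
        nlinarith
  exact tendsto_nhds_unique h1 (h2.mono_left hle)

/-! ### Completely monotone functions -/

namespace IsCompletelyMonotone

variable {f : ℝ → ℝ}

theorem contDiffAt (hf : IsCompletelyMonotone f) {u : ℝ} (hu : 0 < u) : ContDiffAt ℝ ∞ f u :=
  hf.1.contDiffAt (Ioi_mem_nhds hu)

theorem nonneg (hf : IsCompletelyMonotone f) {u : ℝ} (hu : 0 < u) : 0 ≤ f u := by
  simpa using hf.2 0 u hu

theorem antitoneOn_iteratedDeriv (hf : IsCompletelyMonotone f) (n : ℕ) :
    AntitoneOn (fun u => (-1) ^ n * iteratedDeriv n f u) (Ioi 0) := by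
  have hd : DifferentiableOn ℝ (iteratedDeriv n f) (Ioi 0) :=
    (hf.1.differentiableOn_iteratedDerivWithin (m := n) (by exact_mod_cast ENat.natCast_lt_top n)
      isOpen_Ioi.uniqueDiffOn).congr
        (fun u hu => (iteratedDerivWithin_of_isOpen isOpen_Ioi hu).symm)
  have hd' := hd.const_mul ((-1) ^ n)
  refine antitoneOn_of_deriv_nonpos (convex_Ioi 0) hd'.continuousOn (by rwa [interior_Ioi])
    fun u hu => ?_
  rw [interior_Ioi] at hu
  have h := hf.2 (n + 1) u hu
  rw [iteratedDeriv_succ, pow_succ] at h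
  rw [deriv_const_mul _ ((hd u hu).differentiableAt (Ioi_mem_nhds hu))]
  linarith

theorem antitoneOn (hf : IsCompletelyMonotone f) : AntitoneOn f (Ioi 0) := by
  simpa using hf.antitoneOn_iteratedDeriv 0

/-- Each signed derivative `(-1) ^ n f⁽ⁿ⁾` is decreasing, so its backward differences are
nonnegative. -/
theorem sub_comp_add_const (hf : IsCompletelyMonotone f) {δ : ℝ} (hδ : 0 < δ) :
    IsCompletelyMonotone fun u => f u - f (u + δ) := by
  have hs : ContDiffOn ℝ ∞ (fun u => f (u + δ)) (Ioi 0) :=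
    hf.1.comp (contDiff_id.add contDiff_const).contDiffOn fun u hu =>
      add_pos (mem_Ioi.1 hu) hδ
  refine ⟨hf.1.sub hs, fun n u hu => ?_⟩
  rw [iteratedDeriv_fun_sub ((hf.contDiffAt hu).of_le (by exact_mod_cast le_top))
    ((hs.contDiffAt (Ioi_mem_nhds hu)).of_le (by exact_mod_cast le_top)),
    iteratedDeriv_comp_add_const]
  have := hf.antitoneOn_iteratedDeriv n (mem_Ioi.2 hu) (mem_Ioi.2 (add_pos hu hδ))
    (le_add_of_nonneg_right hδ.le)
  simp only at this
  linarith

/-- Each factor `1 - X` replaces `f` by `f - f(· + δ)`, which is again completely monotone. -/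
theorem momentFunctional_nonneg (hf : IsCompletelyMonotone f) {a δ : ℝ} (ha : 0 < a)
    (hδ : 0 < δ) (i k : ℕ) :
    0 ≤ momentFunctional (fun k => f (a + k * δ))
      (Polynomial.X ^ k * (1 - Polynomial.X) ^ i) := by
  induction i generalizing f with
  | zero =>
    rw [pow_zero, mul_one, momentFunctional_X_pow]
    exact hf.nonneg (by positivity)
  | succ i ih =>
    rw [pow_succ, ← mul_assoc, momentFunctional_mul_one_sub_X]
    convert ih (hf.sub_comp_add_const hδ) using 3
    funext k
    push_cast
    ring_nf

theorem exists_measure_moments (hf : IsCompletelyMonotone f) {a δ : ℝ} (ha : 0 < a)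
    (hδ : 0 < δ) : ∃ P : Measure (Icc (0 : ℝ) 1), IsFiniteMeasure P ∧
      ∀ k : ℕ, ∫ w, (w : ℝ) ^ k ∂P = f (a + k * δ) :=
  exists_measure_of_moments fun i k => hf.momentFunctional_nonneg ha hδ i k

/-- Sampling with mesh `1 / (N + 1)` gives a measure whose image under `w ↦ w ^ (N + 1)` has the
integer moments of `P`, hence equals `P`. So the formula holds at rational exponents, and continuity
gives the rest. -/
theorem exists_measure_rpow (hf : IsCompletelyMonotone f) {a : ℝ} (ha : 0 < a) :
    ∃ P : Measure (Icc (0 : ℝ) 1), IsFiniteMeasure P ∧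
      ∀ t : ℝ, 0 ≤ t → ∫ w, (w : ℝ) ^ t ∂P = f (a + t) := by
  obtain ⟨P, hPf, hP⟩ := hf.exists_measure_moments ha one_pos
  refine ⟨P, hPf, ?_⟩
  have hrat : ∀ k N : ℕ, ∫ w, (w : ℝ) ^ ((k : ℝ) / (N + 1 : ℕ)) ∂P
      = f (a + (k : ℝ) / (N + 1 : ℕ)) := by
    intro k N
    have hN : (0 : ℝ) < (N + 1 : ℕ) := by positivity
    obtain ⟨Q, hQf, hQ⟩ := hf.exists_measure_moments ha (inv_pos.2 hN)
    let φ : Icc (0 : ℝ) 1 → Icc (0 : ℝ) 1 := fun w => ⟨(w : ℝ) ^ (N + 1), pow_nonneg w.2.1 _,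
      pow_le_one₀ w.2.1 w.2.2⟩
    have hφ : Continuous φ := by fun_prop
    have hQP : Q.map φ = P := by
      refine ext_of_moments fun l => ?_
      rw [integral_map hφ.aemeasurable (by fun_prop), hP]
      have := hQ ((N + 1) * l)
      simp only [φ, ← pow_mul, this]
      push_cast at hN ⊢
      congr 2
      field_simp
    have hc : Continuous fun w : Icc (0 : ℝ) 1 => (w : ℝ) ^ ((k : ℝ) / (N + 1 : ℕ)) :=
      continuous_subtype_val.rpow_const fun w => Or.inr (by positivity)
    rw [← hQP, integral_map hφ.aemeasurable hc.aestronglyMeasurable, div_eq_mul_inv, ← hQ k]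
    refine integral_congr_ae (.of_forall fun w => ?_)
    simp only [φ]
    rw [← Real.rpow_natCast, ← Real.rpow_mul w.2.1, mul_comm, mul_assoc,
      inv_mul_cancel₀ hN.ne', mul_one, Real.rpow_natCast]
  intro t ht
  -- The exponent `0` is separate because `t ↦ 0 ^ t` is discontinuous there, and `P` has not yet
  -- been shown to have no mass at `w = 0`.
  rcases ht.eq_or_lt with rfl | ht
  · simpa using hP 0
  let q : ℕ → ℝ := fun n => (⌈t * (n + 1 : ℕ)⌉₊ : ℝ) / (n + 1 : ℕ)
  have hq : Tendsto q atTop (𝓝 t) :=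
    (tendsto_nat_ceil_mul_div_atTop ht.le).comp
      ((tendsto_natCast_atTop_atTop (R := ℝ)).comp (tendsto_add_atTop_nat 1))
  have hq0 : ∀ n, 0 < q n := fun n => by
    have : 0 < ⌈t * (n + 1 : ℕ)⌉₊ := Nat.ceil_pos.2 (by positivity)
    simp only [q]
    positivity
  have h1 : Tendsto (fun n => f (a + q n)) atTop (𝓝 (f (a + t))) :=
    (hf.contDiffAt (add_pos ha ht)).continuousAt.tendsto.comp (hq.const_add a)
  have h2 : Tendsto (fun n => ∫ w, (w : ℝ) ^ (q n) ∂P) atTop (𝓝 (∫ w, (w : ℝ) ^ t ∂P)) := by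
    refine tendsto_integral_of_dominated_convergence (fun _ => 1) (fun n => ?_)
      (integrable_const _) (fun n => .of_forall fun w => ?_) (.of_forall fun w => ?_)
    · exact (continuous_subtype_val.rpow_const fun w =>
        Or.inr (hq0 n).le).aestronglyMeasurable
    · rw [Real.norm_of_nonneg (Real.rpow_nonneg w.2.1 _)]
      exact Real.rpow_le_one w.2.1 w.2.2 (hq0 n).le
    · exact tendsto_const_nhds.rpow hq (Or.inr ht)
  refine tendsto_nhds_unique h2 ?_
  simp only [q, hrat]
  exact h1

/-- **Bernstein's theorem**, with the Laplace transform written as a Mellin transform on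
`[0, 1]`. -/
theorem exists_measure (hf : IsCompletelyMonotone f) :
    ∃ P : Measure (Icc (0 : ℝ) 1), IsFiniteMeasure P ∧ P {w | (w : ℝ) = 0} = 0 ∧
      (∀ k : ℕ, ∫ w, (w : ℝ) ^ k ∂P = f (1 + k)) ∧
      ∀ u : ℝ, 0 < u → ∫⁻ w, ENNReal.ofReal ((w : ℝ) ^ (u - 1)) ∂P = ENNReal.ofReal (f u) := by
  obtain ⟨P, hPf, hP⟩ := hf.exists_measure_rpow one_pos
  have hk : ∀ k : ℕ, ∫ w, (w : ℝ) ^ k ∂P = f (1 + k) := by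
    intro k
    simpa [Real.rpow_natCast] using hP k (Nat.cast_nonneg k)
  -- Starting the samples at `a < 1` gives `Q` with `P = w ^ (1 - a) Q`. The weight vanishes at `w =
  -- 0`, so `P` has no mass there, and the representation extends to all `u > a`.
  have hrep : ∀ a : ℝ, 0 < a → a < 1 → ∃ Q : Measure (Icc (0 : ℝ) 1), IsFiniteMeasure Q ∧
      (∀ t : ℝ, 0 ≤ t → ∫ w, (w : ℝ) ^ t ∂Q = f (a + t)) ∧
      P = Q.withDensity fun w => ENNReal.ofReal ((w : ℝ) ^ (1 - a)) := by
    intro a ha ha1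
    obtain ⟨Q, hQf, hQ⟩ := hf.exists_measure_rpow ha
    refine ⟨Q, hQf, hQ, ?_⟩
    have hfin : IsFiniteMeasure (Q.withDensity fun w => ENNReal.ofReal ((w : ℝ) ^ (1 - a))) := by
      refine isFiniteMeasure_withDensity_ofReal (Integrable.hasFiniteIntegral ?_)
      refine Integrable.of_bound (C := 1) ?_ (.of_forall fun w => ?_)
      · exact (measurable_subtype_coe.pow_const _).aestronglyMeasurable
      · rw [Real.norm_of_nonneg (Real.rpow_nonneg w.2.1 _)]
        exact Real.rpow_le_one w.2.1 w.2.2 (by linarith)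
    refine ext_of_moments fun k => ?_
    rw [hk, integral_withDensity_eq_integral_toReal_smul
      (measurable_subtype_coe.pow_const _).ennreal_ofReal
      (.of_forall fun w => ENNReal.ofReal_lt_top), show 1 + (k : ℝ) = a + (1 - a + k) by ring,
      ← hQ _ (by have : (0 : ℝ) ≤ k := k.cast_nonneg; linarith)]
    refine integral_congr_ae (.of_forall fun w => ?_)
    simp only
    rw [ENNReal.toReal_ofReal (Real.rpow_nonneg w.2.1 _), smul_eq_mul,
      Real.rpow_add_natCast' w.2.1 (by have : (0 : ℝ) ≤ k := k.cast_nonneg; linarith)]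
  refine ⟨P, hPf, ?_, hk, fun u hu => ?_⟩
  · obtain ⟨Q, -, -, hPQ⟩ := hrep (1 / 2) (by norm_num) (by norm_num)
    have hm : MeasurableSet {w : Icc (0 : ℝ) 1 | (w : ℝ) = 0} :=
      measurable_subtype_coe (measurableSet_singleton 0)
    rw [hPQ, withDensity_apply _ hm, setLIntegral_congr_fun (g := fun _ => 0) hm, lintegral_zero]
    intro w hw
    simp only
    rw [show (w : ℝ) = 0 from hw, Real.zero_rpow (by norm_num), ENNReal.ofReal_zero]
  · set a : ℝ := min u 1 / 2 with ha_def
    have ha : 0 < a := by positivity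
    have ha1 : a < 1 := by have := min_le_right u 1; linarith
    have hau : a < u := by have := min_le_left u 1; linarith
    obtain ⟨Q, hQf, hQ, hPQ⟩ := hrep a ha ha1
    have hm : ∀ t : ℝ, Measurable fun w : Icc (0 : ℝ) 1 => ENNReal.ofReal ((w : ℝ) ^ t) :=
      fun t => (measurable_subtype_coe.pow_const _).ennreal_ofReal
    have h2 := hQ (u - a) (by linarith)
    rw [add_sub_cancel] at h2
    rw [hPQ, lintegral_withDensity_eq_lintegral_mul _ (hm _) (hm _), ← h2,
      ofReal_integral_eq_lintegral_ofReal]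
    · refine lintegral_congr fun w => ?_
      rw [Pi.mul_apply, ← ENNReal.ofReal_mul (Real.rpow_nonneg w.2.1 _)]
      congr 1
      rcases w.2.1.eq_or_lt with h0 | h0
      · rw [← h0, Real.zero_rpow (show (1 : ℝ) - a ≠ 0 by linarith),
          Real.zero_rpow (show u - a ≠ 0 by linarith), zero_mul]
      · rw [← Real.rpow_add h0]
        ring_nf
    · refine Integrable.of_bound (C := 1) ?_ (.of_forall fun w => ?_)
      · exact (measurable_subtype_coe.pow_const _).aestronglyMeasurable
      · rw [Real.norm_of_nonneg (Real.rpow_nonneg w.2.1 _)]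
        exact Real.rpow_le_one w.2.1 w.2.2 (by linarith)
    · exact .of_forall fun w => Real.rpow_nonneg w.2.1 _

end IsCompletelyMonotone

/-- The function is the moment generating function of `-1 / s`, analytic where exponential moments
are finite; each derivative brings down a factor `-1 / s < 0`. -/
theorem isCompletelyMonotone_toReal_lintegral_exp {Q : Measure ℝ} (h0 : Q (Iic 0) = 0)
    (hfin : ∀ u : ℝ, 0 < u → ∫⁻ s, ENNReal.ofReal (Real.exp (-(u / s))) ∂Q < ⊤) :
    IsCompletelyMonotone fun u => (∫⁻ s, ENNReal.ofReal (Real.exp (-(u / s))) ∂Q).toReal := by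
  let X : ℝ → ℝ := fun s => -s⁻¹
  have hX : ∀ u s : ℝ, Real.exp (u * X s) = Real.exp (-(u / s)) := by
    intro u s; simp only [X]; congr 1; ring
  have hmgf : (fun u => (∫⁻ s, ENNReal.ofReal (Real.exp (-(u / s))) ∂Q).toReal) = mgf X Q := by
    funext u
    rw [mgf, integral_eq_lintegral_of_nonneg_ae (.of_forall fun s => (Real.exp_pos _).le)
      (by fun_prop)]
    simp_rw [hX]
  have hsub : Ioi 0 ⊆ interior (integrableExpSet X Q) := by
    refine interior_maximal (fun u hu => ?_) isOpen_Ioi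
    refine ⟨by fun_prop, ?_⟩
    rw [hasFiniteIntegral_iff_ofReal (.of_forall fun s => (Real.exp_pos _).le)]
    simp_rw [hX]
    exact hfin u hu
  rw [hmgf]
  refine ⟨(analyticOn_mgf.mono hsub).contDiffOn isOpen_Ioi.uniqueDiffOn, fun n u hu => ?_⟩
  rw [iteratedDeriv_mgf (hsub hu), ← integral_const_mul]
  refine integral_nonneg_of_ae ?_
  have : ∀ᵐ s ∂Q, s ∉ Iic (0 : ℝ) := measure_eq_zero_iff_ae_notMem.1 h0
  filter_upwards [this] with s hs
  have hs0 : 0 < s := not_le.1 hs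
  rw [Pi.zero_apply, ← mul_assoc, ← mul_pow]
  simp only [X]
  rw [neg_one_mul, neg_neg]
  positivity

/-! ### Polar decompositions of mixtures of exponential rays -/

/-- The integral of `1 ∧ r ^ 2` against the exponential kernel. -/
def expWeight (p : ℕ) (s : ℝ) : ℝ≥0∞ :=
  ∫⁻ r in Ioi (0 : ℝ), ENNReal.ofReal (min 1 (r ^ 2)) * expKernel p r s

theorem measurable_expWeight (p : ℕ) : Measurable (expWeight p) := by
  refine Measurable.lintegral_prod_right' (f := fun q : ℝ × ℝ =>
    ENNReal.ofReal (min 1 (q.2 ^ 2)) * expKernel p q.2 q.1) ?_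
  exact (by fun_prop : Measurable fun q : ℝ × ℝ => ENNReal.ofReal (min 1 (q.2 ^ 2))).mul
    ((measurable_expKernel p).comp measurable_swap)

theorem setLIntegral_min_one_sq_pos {b : ℝ} (hb : 0 < b) :
    0 < ∫⁻ r in Ioo (0 : ℝ) b, ENNReal.ofReal (min 1 (r ^ 2)) := by
  rw [setLIntegral_pos_iff (by fun_prop)]
  refine lt_of_lt_of_le (?_ : 0 < volume (Ioo 0 b)) (measure_mono fun r hr => ⟨?_, hr⟩)
  · simpa using hb
  · have : 0 < r := hr.1
    exact (ENNReal.ofReal_pos.2 (by positivity)).ne'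

/-- For `0 < r < min u 1` one has `r ^ p ≤ r ≤ u`. Thus `exp (-u / s)` divided by the weight is
bounded in `s`, which keeps the Laplace transforms of the radial components finite. -/
theorem mul_exp_le_expWeight {p : ℕ} (hp : 1 ≤ p) {u s : ℝ} (hs : 0 < s) :
    (∫⁻ r in Ioo (0 : ℝ) (min u 1), ENNReal.ofReal (min 1 (r ^ 2)))
      * ENNReal.ofReal (Real.exp (-(u / s))) ≤ expWeight p s := by
  rw [← lintegral_mul_const _ (by fun_prop)]
  refine (setLIntegral_mono ?_ fun r hr => ?_).trans
    (lintegral_mono_set (Ioo_subset_Ioi_self : Ioo (0 : ℝ) (min u 1) ⊆ Ioi 0))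
  · exact (by fun_prop : Measurable fun r : ℝ => ENNReal.ofReal (min 1 (r ^ 2))).mul
      ((measurable_expKernel p).comp (by fun_prop : Measurable fun r : ℝ => (r, s)))
  · unfold expKernel
    have h1 : r ^ p ≤ u := by
      refine (pow_le_of_le_one hr.1.le ?_ (by omega)).trans ?_
      · exact hr.2.le.trans (min_le_right _ _)
      · exact hr.2.le.trans (min_le_left _ _)
    gcongr

theorem expWeight_pos {p : ℕ} (hp : 1 ≤ p) {s : ℝ} (hs : 0 < s) : 0 < expWeight p s := by
  refine lt_of_lt_of_le ?_ (mul_exp_le_expWeight hp (u := 1) hs)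
  exact ENNReal.mul_pos (setLIntegral_min_one_sq_pos (by simp)).ne'
    (ENNReal.ofReal_pos.2 (Real.exp_pos _)).ne'

theorem expWeight_lt_top {p : ℕ} (hp : 1 ≤ p) {s : ℝ} (hs : 0 < s) : expWeight p s < ⊤ := by
  have hi := integrableOn_rpow_mul_exp_neg_mul_rpow (p := p) (s := 0) (b := s⁻¹) (by norm_num)
    (by exact_mod_cast hp) (inv_pos.2 hs)
  refine lt_of_le_of_lt (setLIntegral_mono (by fun_prop) fun r hr => ?_) hi.lintegral_lt_top
  have h1 : r ^ (0 : ℝ) * Real.exp (-s⁻¹ * r ^ (p : ℝ)) = Real.exp (-(r ^ p / s)) := by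
    rw [Real.rpow_zero, one_mul, Real.rpow_natCast]; congr 1; ring
  rw [h1, expKernel]
  refine mul_le_of_le_one_left zero_le ?_
  rw [← ENNReal.ofReal_one]
  exact ENNReal.ofReal_le_ofReal (min_le_left _ _)

/-- Polar coordinates and disintegration for a measure which integrates `c(|x|)`. -/
theorem exists_polar_disintegration {d : ℕ} (η : Measure (EuclideanSpace ℝ (Fin d)))
    {c : ℝ → ℝ≥0∞} (hc : Measurable c) (hc0 : ∀ s, 0 < s → c s ≠ 0) (hct : ∀ s, 0 < s → c s ≠ ⊤)
    (hfin : ∫⁻ x in {0}ᶜ, c ‖x‖ ∂η < ⊤) :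
    ∃ (σ : Measure (sphere (0 : EuclideanSpace ℝ (Fin d)) 1))
      (K : Kernel (sphere (0 : EuclideanSpace ℝ (Fin d)) 1) ℝ),
      IsFiniteMeasure σ ∧ IsMarkovKernel K ∧ (∀ ξ, K ξ (Iic 0) = 0) ∧
      ∀ G : ℝ × EuclideanSpace ℝ (Fin d) → ℝ≥0∞, Measurable G →
        ∫⁻ x in {0}ᶜ, G (‖x‖, ‖x‖⁻¹ • x) ∂η
          = ∫⁻ ξ, (∫⁻ s, (c s)⁻¹ * G (s, (ξ : EuclideanSpace ℝ (Fin d))) ∂(K ξ)) ∂σ := by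
  classical
  have h0 : MeasurableSet ({0}ᶜ : Set (EuclideanSpace ℝ (Fin d))) :=
    (measurableSet_singleton 0).compl
  let φ : ({0}ᶜ : Set (EuclideanSpace ℝ (Fin d))) →
      sphere (0 : EuclideanSpace ℝ (Fin d)) 1 × ℝ := fun x =>
    ((homeomorphUnitSphereProd (EuclideanSpace ℝ (Fin d)) x).1, ‖(x : EuclideanSpace ℝ (Fin d))‖)
  have hφ : Measurable φ :=
    ((homeomorphUnitSphereProd _).continuous.fst.prodMk (by fun_prop)).measurable
  -- Weighting by `c` makes the measure finite, so that it can be disintegrated; the factor `(c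
  -- s)⁻¹` restores it afterwards.
  let ζ : Measure (EuclideanSpace ℝ (Fin d)) := (η.restrict {0}ᶜ).withDensity fun x => c ‖x‖
  let Z : Measure (sphere (0 : EuclideanSpace ℝ (Fin d)) 1 × ℝ) :=
    (ζ.comap (Subtype.val : ({0}ᶜ : Set (EuclideanSpace ℝ (Fin d))) → _)).map φ
  have hZ : ∀ G : ℝ × EuclideanSpace ℝ (Fin d) → ℝ≥0∞, Measurable G →
      ∫⁻ q, G (q.2, (q.1 : EuclideanSpace ℝ (Fin d))) ∂Z
        = ∫⁻ x in {0}ᶜ, c ‖x‖ * G (‖x‖, ‖x‖⁻¹ • x) ∂η := by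
    intro G hG
    have hG' : Measurable fun q : sphere (0 : EuclideanSpace ℝ (Fin d)) 1 × ℝ =>
        G (q.2, (q.1 : EuclideanSpace ℝ (Fin d))) := hG.comp (by fun_prop)
    have hG2 : Measurable fun x : EuclideanSpace ℝ (Fin d) => G (‖x‖, ‖x‖⁻¹ • x) :=
      hG.comp (by fun_prop)
    rw [lintegral_map hG' hφ]
    simp only [φ, homeomorphUnitSphereProd_apply_fst_coe]
    rw [lintegral_subtype_comap h0 fun x => G (‖x‖, ‖x‖⁻¹ • x), restrict_withDensity h0,
      Measure.restrict_restrict h0, inter_self,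
      lintegral_withDensity_eq_lintegral_mul _ (by fun_prop) hG2]
    rfl
  have hZfin : IsFiniteMeasure Z := by
    refine ⟨?_⟩
    have := hZ (fun _ => 1) measurable_const
    simp only [lintegral_one, mul_one] at this
    rw [this]
    exact hfin
  have hZ0 : ∀ᵐ q ∂Z, q.2 ∉ Iic (0 : ℝ) := by
    refine (ae_map_iff hφ.aemeasurable (measurable_snd measurableSet_Iic).compl).2
      (.of_forall fun x => ?_)
    exact not_le.2 (norm_pos_iff.2 x.2)
  have hZc : Z.fst ⊗ₘ Z.condKernel = Z := Z.disintegrate Z.condKernel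
  have hg : MeasurableSet {ξ | Z.condKernel ξ (Iic 0) = 0} :=
    Kernel.measurable_coe _ measurableSet_Iic (measurableSet_singleton 0)
  have hgae : ∀ᵐ ξ ∂Z.fst, Z.condKernel ξ (Iic 0) = 0 := by
    rw [← hZc, Measure.ae_compProd_iff (p := fun q => q.2 ∉ Iic (0 : ℝ))
      (measurable_snd measurableSet_Iic).compl] at hZ0
    filter_upwards [hZ0] with ξ hξ
    exact measure_eq_zero_iff_ae_notMem.2 hξ
  -- The conditional laws charge only `(0, ∞)` for almost every direction; replacing the others by
  -- the point mass at `1` makes this hold for all directions.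
  let K : Kernel (sphere (0 : EuclideanSpace ℝ (Fin d)) 1) ℝ :=
    Kernel.piecewise hg Z.condKernel (Kernel.const _ (Measure.dirac 1))
  have hKapply : ∀ ξ, K ξ = if Z.condKernel ξ (Iic 0) = 0 then Z.condKernel ξ
      else Measure.dirac 1 := fun ξ => Kernel.piecewise_apply ξ
  have hKM : IsMarkovKernel K := by infer_instance
  have hKZ : Z.fst ⊗ₘ K = Z := by
    refine (Measure.compProd_congr ?_).trans hZc
    filter_upwards [hgae] with ξ hξ
    rw [hKapply, if_pos hξ]
  refine ⟨Z.fst, K, inferInstance, hKM, fun ξ => ?_, fun G hG => ?_⟩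
  · rw [hKapply]
    split_ifs with h
    · exact h
    · rw [Measure.dirac_apply' _ measurableSet_Iic]
      simp
  · have hG' : Measurable fun q : ℝ × EuclideanSpace ℝ (Fin d) => (c q.1)⁻¹ * G q :=
      (hc.comp measurable_fst).inv.mul hG
    have hm : Measurable fun q : sphere (0 : EuclideanSpace ℝ (Fin d)) 1 × ℝ =>
        (c q.2)⁻¹ * G (q.2, (q.1 : EuclideanSpace ℝ (Fin d))) :=
      hG'.comp (by fun_prop : Measurable fun q : sphere (0 : EuclideanSpace ℝ (Fin d)) 1 × ℝ =>
        (q.2, (q.1 : EuclideanSpace ℝ (Fin d))))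
    rw [← Measure.lintegral_compProd hm, hKZ, hZ _ hG']
    refine setLIntegral_congr_fun h0 fun x hx => ?_
    have hx0 : 0 < ‖x‖ := norm_pos_iff.2 hx
    rw [← mul_assoc, ENNReal.mul_inv_cancel (hc0 _ hx0) (hct _ hx0), one_mul]

theorem IsLevyMeasure.lintegral_expWeight_lt_top {d p : ℕ} {η : Measure (EuclideanSpace ℝ (Fin d))}
    (hν : IsLevyMeasure (rayTransform (expKernel p) η)) :
    ∫⁻ x in {0}ᶜ, expWeight p ‖x‖ ∂η < ⊤ := by
  have h1 := hν.lintegral_lt_top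
  rw [lintegral_rayTransform (measurable_expKernel p) _ (by fun_prop)] at h1
  refine lt_of_le_of_lt (le_of_eq ?_) h1
  refine setLIntegral_congr_fun (measurableSet_singleton 0).compl fun x hx => ?_
  refine setLIntegral_congr_fun measurableSet_Ioi fun r hr => ?_
  rw [norm_smul_inv_norm_smul hx hr, mul_comm]

/-- Disintegrate `η` into directions and radii with the weight `expWeight p`, which is integrable
because the mixture is a Lévy measure. The radial density in direction `ξ` is then a Laplace mixture
evaluated at `r ^ p`. -/
theorem exists_polarDecomposition_rayTransform {d : ℕ} {p : ℕ} (hp : 1 ≤ p)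
    (η : Measure (EuclideanSpace ℝ (Fin d))) (hν : IsLevyMeasure (rayTransform (expKernel p) η)) :
    ∃ σ κ, IsPolarDecomposition (rayTransform (expKernel p) η) σ κ ∧
      ∀ᵐ ξ ∂σ, ∃ g : ℝ → ℝ, IsCompletelyMonotone g ∧
        κ ξ = (volume.restrict (Ioi 0)).withDensity (fun r => ENNReal.ofReal (g (r ^ p))) := by
  have hfin := hν.lintegral_expWeight_lt_top
  obtain ⟨σ, K, hσ, hK, hK0, hG⟩ := exists_polar_disintegration η (measurable_expWeight p)
    (fun s hs => (expWeight_pos hp hs).ne') (fun s hs => (expWeight_lt_top hp hs).ne) hfin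
  have hK0' : ∀ ξ, ∀ᵐ s ∂(K ξ), 0 < s := fun ξ => by
    filter_upwards [measure_eq_zero_iff_ae_notMem.1 (hK0 ξ)] with s hs using not_le.1 hs
  let Q : sphere (0 : EuclideanSpace ℝ (Fin d)) 1 → Measure ℝ := fun ξ =>
    (K ξ).withDensity fun s => (expWeight p s)⁻¹
  have hw : Measurable fun s => (expWeight p s)⁻¹ := (measurable_expWeight p).inv
  have hkm' : ∀ r, Measurable fun s => (expWeight p s)⁻¹ * expKernel p r s := fun r =>
    hw.mul ((measurable_expKernel p).comp (by fun_prop : Measurable fun s : ℝ => (r, s)))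
  have hQ : ∀ ξ u, ∫⁻ s, ENNReal.ofReal (Real.exp (-(u / s))) ∂(Q ξ)
      = ∫⁻ s, (expWeight p s)⁻¹ * ENNReal.ofReal (Real.exp (-(u / s))) ∂(K ξ) := fun ξ u =>
    lintegral_withDensity_eq_lintegral_mul _ hw (by fun_prop)
  have hQfin : ∀ ξ u, 0 < u → ∫⁻ s, ENNReal.ofReal (Real.exp (-(u / s))) ∂(Q ξ) < ⊤ := by
    intro ξ u hu
    have hc := setLIntegral_min_one_sq_pos (lt_min hu one_pos)
    set c := ∫⁻ r in Ioo (0 : ℝ) (min u 1), ENNReal.ofReal (min 1 (r ^ 2))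
    rw [hQ]
    -- The integrand is at most `c⁻¹`, and `K ξ` is a probability measure.
    refine lt_of_le_of_lt (lintegral_mono_ae (g := fun _ => c⁻¹) ?_) ?_
    · filter_upwards [hK0' ξ] with s hs
      have h1 : c * ENNReal.ofReal (Real.exp (-(u / s))) ≤ expWeight p s :=
        mul_exp_le_expWeight hp hs
      rw [← ENNReal.div_eq_inv_mul, ENNReal.div_le_iff (expWeight_pos hp hs).ne'
        (expWeight_lt_top hp hs).ne, ← ENNReal.div_eq_inv_mul, ENNReal.le_div_iff_mul_le
        (Or.inl hc.ne') (Or.inr (expWeight_lt_top hp hs).ne), mul_comm]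
      exact h1
    · simpa using hc
  have hq : Measurable (Function.uncurry fun (ξ : sphere (0 : EuclideanSpace ℝ (Fin d)) 1)
      (r : ℝ) => ∫⁻ s, (expWeight p s)⁻¹ * expKernel p r s ∂(K ξ)) := by
    refine Measurable.lintegral_kernel_prod_right'
      (κ := Kernel.prodMkRight ℝ K) (f := fun q : (sphere (0 : EuclideanSpace ℝ (Fin d)) 1 × ℝ) × ℝ
        => (expWeight p q.2)⁻¹ * expKernel p q.1.2 q.2) ?_
    exact (hw.comp measurable_snd).mul ((measurable_expKernel p).comp
      (by fun_prop : Measurable fun q : (sphere (0 : EuclideanSpace ℝ (Fin d)) 1 × ℝ) × ℝ =>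
        (q.1.2, q.2)))
  let κ : Kernel (sphere (0 : EuclideanSpace ℝ (Fin d)) 1) ℝ :=
    Kernel.withDensity (Kernel.const _ (volume.restrict (Ioi (0 : ℝ))))
      fun ξ r => ∫⁻ s, (expWeight p s)⁻¹ * expKernel p r s ∂(K ξ)
  have hκ : ∀ ξ, κ ξ = (volume.restrict (Ioi 0)).withDensity
      fun r => ∫⁻ s, (expWeight p s)⁻¹ * expKernel p r s ∂(K ξ) := fun ξ => by
    simp only [κ]
    rw [Kernel.withDensity_apply _ hq, Kernel.const_apply]
  have hκr : ∀ ξ, (κ ξ).restrict (Ioi 0) = κ ξ := fun ξ => by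
    rw [hκ, restrict_withDensity measurableSet_Ioi, Measure.restrict_restrict measurableSet_Ioi,
      inter_self]
  have hqξ : ∀ ξ, Measurable fun r : ℝ => ∫⁻ s, (expWeight p s)⁻¹ * expKernel p r s ∂(K ξ) :=
    fun ξ => hq.comp (by fun_prop : Measurable fun r : ℝ => (ξ, r))
  refine ⟨σ, κ, ⟨fun ξ => ?_, fun ξ => ?_, fun B hB => ?_⟩, .of_forall fun ξ => ?_⟩
  · rw [← hκr, Measure.restrict_apply measurableSet_Iic, Iic_inter_Ioi, Ioc_self, measure_empty]
  · rw [hκ, withDensity_apply _ measurableSet_Ioi, Measure.restrict_restrict measurableSet_Ioi,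
      inter_self, setLIntegral_pos_iff (hqξ ξ)]
    refine lt_of_lt_of_le (by simp : 0 < volume (Ioi (0 : ℝ)))
      (measure_mono fun r hr => ⟨?_, hr⟩)
    intro h0
    have h0 := (lintegral_eq_zero_iff (hkm' r)).1 h0
    have : ∀ᵐ s ∂(K ξ), False := by
      filter_upwards [h0, hK0' ξ] with s hs hs0
      rcases mul_eq_zero.1 hs with h | h
      · exact (expWeight_lt_top hp hs0).ne (ENNReal.inv_eq_zero.1 h)
      · exact (ENNReal.ofReal_pos.2 (Real.exp_pos _)).ne' h
    rw [eventually_false_iff_eq_bot, ae_eq_bot] at this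
    exact IsProbabilityMeasure.ne_zero (K ξ) this
  · have hBm : Measurable (B.indicator (1 : EuclideanSpace ℝ (Fin d) → ℝ≥0∞)) :=
      measurable_one.indicator hB
    have hGm : Measurable fun q : ℝ × EuclideanSpace ℝ (Fin d) =>
        ∫⁻ r in Ioi (0 : ℝ), expKernel p r q.1 * B.indicator 1 (r • q.2) := by
      refine Measurable.lintegral_prod_right' (f := fun z : (ℝ × EuclideanSpace ℝ (Fin d)) × ℝ =>
        expKernel p z.2 z.1.1 * B.indicator 1 (z.2 • z.1.2)) ?_
      exact ((measurable_expKernel p).comp (by fun_prop : Measurable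
        fun z : (ℝ × EuclideanSpace ℝ (Fin d)) × ℝ => (z.2, z.1.1))).mul (hBm.comp (by fun_prop))
    rw [← lintegral_indicator_one hB, lintegral_rayTransform (measurable_expKernel p) _ hBm,
      hG _ hGm]
    refine lintegral_congr fun ξ => ?_
    have hrm : Measurable fun r : ℝ => B.indicator (1 : EuclideanSpace ℝ (Fin d) → ℝ≥0∞)
        (r • (ξ : EuclideanSpace ℝ (Fin d))) := hBm.comp (by fun_prop)
    rw [hκr, hκ, lintegral_withDensity_eq_lintegral_mul _ (hqξ ξ)
      (g := fun r => B.indicator (fun _ => (1 : ℝ≥0∞)) (r • (ξ : EuclideanSpace ℝ (Fin d)))) hrm]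
    have hkm : ∀ s, Measurable fun r => expKernel p r s :=
      fun s => (measurable_expKernel p).comp (by fun_prop : Measurable fun r : ℝ => (r, s))
    have e1 : ∀ s, (expWeight p s)⁻¹ * ∫⁻ r in Ioi (0 : ℝ), expKernel p r s *
        B.indicator 1 (r • (ξ : EuclideanSpace ℝ (Fin d)))
        = ∫⁻ r in Ioi (0 : ℝ), (expWeight p s)⁻¹ * expKernel p r s *
        B.indicator 1 (r • (ξ : EuclideanSpace ℝ (Fin d))) := by
      intro s
      have h2 := lintegral_const_mul (μ := volume.restrict (Ioi (0 : ℝ))) (expWeight p s)⁻¹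
        ((hkm s).mul hrm)
      simp only [Pi.mul_apply, ← mul_assoc] at h2
      exact h2.symm
    simp_rw [e1]
    rw [lintegral_lintegral_swap]
    · refine lintegral_congr fun r => ?_
      rw [lintegral_mul_const _ (hkm' r)]
      rfl
    · refine Measurable.aemeasurable ?_
      exact ((hw.comp measurable_fst).mul ((measurable_expKernel p).comp measurable_swap)).mul
        (hrm.comp measurable_snd)
  · refine ⟨fun u => (∫⁻ s, ENNReal.ofReal (Real.exp (-(u / s))) ∂(Q ξ)).toReal,
      isCompletelyMonotone_toReal_lintegral_exp ?_ (hQfin ξ), ?_⟩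
    · exact withDensity_absolutelyContinuous _ _ (hK0 ξ)
    · rw [hκ]
      refine withDensity_congr_ae ?_
      filter_upwards [ae_restrict_mem measurableSet_Ioi] with r hr
      rw [ENNReal.ofReal_toReal (hQfin ξ _ (pow_pos (mem_Ioi.1 hr) p)).ne, hQ]
      rfl

/-! ### Radial components with completely monotone densities -/

/-- Mixtures of a measurable family of finite measures. -/
theorem exists_measure_lintegral_prod {α β : Type*} [MeasurableSpace α] [MeasurableSpace β]
    (σ : Measure α) {P : α → Measure β} (hP : Measurable P) [hfin : ∀ a, IsFiniteMeasure (P a)] :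
    ∃ Z : Measure (α × β), ∀ F : α × β → ℝ≥0∞, Measurable F →
      ∫⁻ q, F q ∂Z = ∫⁻ a, (∫⁻ b, F (a, b) ∂(P a)) ∂σ := by
  have hc : Measurable fun a => P a univ := (Measure.measurable_coe MeasurableSet.univ).comp hP
  -- Normalizing gives a kernel of mass at most `1`, for which measures of sections are measurable.
  -- If `P a = 0`, the convention `0⁻¹ = ⊤` still yields the zero measure.
  let K : Kernel α β := ⟨fun a => (P a univ)⁻¹ • P a, by
    refine Measure.measurable_of_measurable_coe _ fun B hB => ?_
    simp only [Measure.smul_apply, smul_eq_mul]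
    exact hc.inv.mul ((Measure.measurable_coe hB).comp hP)⟩
  have hK : ∀ a, K a = (P a univ)⁻¹ • P a := fun _ => rfl
  have hKfin : IsFiniteKernel K := ⟨1, ENNReal.one_lt_top, fun a => by
    rw [hK, Measure.smul_apply, smul_eq_mul]
    exact ENNReal.inv_mul_le_one _⟩
  have hPK : ∀ a, P a = P a univ • K a := fun a => by
    rw [hK, smul_smul]
    rcases eq_or_ne (P a univ) 0 with h | h
    · rw [Measure.measure_univ_eq_zero.1 h, smul_zero]
    · rw [ENNReal.mul_inv_cancel h (measure_ne_top _ _), one_smul]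
  have hm : Measurable fun a => (P a).map (Prod.mk a) := by
    refine Measure.measurable_of_measurable_coe _ fun B hB => ?_
    have : ∀ a, (P a).map (Prod.mk a) B = P a univ * K a (Prod.mk a ⁻¹' B) := fun a => by
      rw [Measure.map_apply measurable_prodMk_left hB]
      conv_lhs => rw [hPK a]
      rfl
    simp_rw [this]
    exact hc.mul (Kernel.measurable_kernel_prodMk_left hB)
  refine ⟨σ.bind fun a => (P a).map (Prod.mk a), fun F hF => ?_⟩
  rw [Measure.lintegral_bind hm.aemeasurable hF.aemeasurable]
  exact lintegral_congr fun a => lintegral_map hF measurable_prodMk_left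

/-- The decreasing density is squeezed between its values at the ends of a shrinking interval. This
recovers pointwise values of the density from the measure alone, hence measurably in a parameter. -/
theorem IsCompletelyMonotone.tendsto_withDensity_Ioc {f : ℝ → ℝ} (hf : IsCompletelyMonotone f)
    (p : ℕ) {a : ℝ} (ha : 0 < a) :
    Tendsto (fun n : ℕ => ((n : ℝ) + 1) * ((volume.restrict (Ioi 0)).withDensity
      (fun r => ENNReal.ofReal (f (r ^ p))) (Ioc a (a + 1 / ((n : ℝ) + 1)))).toReal) atTop
      (𝓝 (f (a ^ p))) := by
  have hb : Tendsto (fun n : ℕ => a + 1 / ((n : ℝ) + 1)) atTop (𝓝 a) := by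
    simpa using tendsto_one_div_add_atTop_nhds_zero_nat.const_add a
  have hlow : Tendsto (fun n : ℕ => f ((a + 1 / ((n : ℝ) + 1)) ^ p)) atTop (𝓝 (f (a ^ p))) :=
    ((hf.contDiffAt (pow_pos ha p)).continuousAt.tendsto).comp (hb.pow p)
  have hval : ∀ n : ℕ, (volume.restrict (Ioi 0)).withDensity
      (fun r => ENNReal.ofReal (f (r ^ p))) (Ioc a (a + 1 / ((n : ℝ) + 1)))
      = ∫⁻ r in Ioc a (a + 1 / ((n : ℝ) + 1)), ENNReal.ofReal (f (r ^ p)) := fun n => by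
    rw [withDensity_apply _ measurableSet_Ioc, Measure.restrict_restrict measurableSet_Ioc,
      inter_eq_left.2 fun r hr => mem_Ioi.2 (ha.trans hr.1)]
  have hconst : ∀ (n : ℕ) (c : ℝ), 0 ≤ c → ∫⁻ _ in Ioc a (a + 1 / ((n : ℝ) + 1)),
      ENNReal.ofReal c = ENNReal.ofReal (c * (1 / ((n : ℝ) + 1))) := fun n c hc => by
    rw [setLIntegral_const, Real.volume_Ioc, add_sub_cancel_left, ENNReal.ofReal_mul hc]
  have hup : ∀ n : ℕ, ∫⁻ r in Ioc a (a + 1 / ((n : ℝ) + 1)), ENNReal.ofReal (f (r ^ p))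
      ≤ ENNReal.ofReal (f (a ^ p) * (1 / ((n : ℝ) + 1))) := fun n => by
    rw [← hconst n _ (hf.nonneg (pow_pos ha p))]
    refine setLIntegral_mono measurable_const fun r hr => ENNReal.ofReal_le_ofReal ?_
    exact hf.antitoneOn (pow_pos ha p) (pow_pos (ha.trans hr.1) p)
      (pow_le_pow_left₀ ha.le hr.1.le p)
  refine tendsto_of_tendsto_of_tendsto_of_le_of_le hlow tendsto_const_nhds (fun n => ?_)
    fun n => ?_
  · have hn : (0 : ℝ) < n + 1 := by positivity
    have hb0 : 0 < a + 1 / ((n : ℝ) + 1) := by positivity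
    have hf0 := hf.nonneg (pow_pos hb0 p)
    simp only
    rw [hval, ← div_le_iff₀' hn, div_eq_mul_one_div, ← ENNReal.ofReal_le_iff_le_toReal
      ((hup n).trans_lt ENNReal.ofReal_lt_top).ne, ← hconst n _ hf0]
    refine setLIntegral_mono' measurableSet_Ioc fun r hr => ENNReal.ofReal_le_ofReal ?_
    exact hf.antitoneOn (pow_pos (ha.trans hr.1) p) (pow_pos hb0 p)
      (pow_le_pow_left₀ (ha.trans hr.1).le hr.2 p)
  · have hn : (0 : ℝ) < n + 1 := by positivity
    have hf0 := hf.nonneg (pow_pos ha p)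
    simp only
    rw [hval, ← le_div_iff₀' hn, div_eq_mul_one_div (f _)]
    exact ENNReal.toReal_le_of_le_ofReal (by positivity) (hup n)

/-- The point `w = 1` stands for scale `s = ∞`: an atom there would bound `f` below by a positive
constant and make the mass of `(1, ∞)` infinite. -/
theorem IsCompletelyMonotone.exists_measure_of_withDensity_lt_top {f : ℝ → ℝ}
    (hf : IsCompletelyMonotone f) {p : ℕ}
    (hfin : (volume.restrict (Ioi 0)).withDensity (fun r => ENNReal.ofReal (f (r ^ p))) (Ioi 1)
      < ⊤) :
    ∃ P : Measure (Icc (0 : ℝ) 1), IsFiniteMeasure P ∧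
      (∀ᵐ w : Icc (0 : ℝ) 1 ∂P, 0 < (w : ℝ) ∧ (w : ℝ) < 1) ∧
      (∀ k : ℕ, ∫ w, (w : ℝ) ^ k ∂P = f (1 + k)) ∧
      ∀ u, 0 < u → ∫⁻ w, ENNReal.ofReal ((w : ℝ) ^ (u - 1)) ∂P = ENNReal.ofReal (f u) := by
  obtain ⟨P, hP, h0, hmom, hu⟩ := hf.exists_measure
  refine ⟨P, hP, ?_, hmom, hu⟩
  have h1 : P {w | (w : ℝ) = 1} = 0 := by
    by_contra hne
    refine hfin.ne (top_le_iff.1 ?_)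
    have hm : MeasurableSet {w : Icc (0 : ℝ) 1 | (w : ℝ) = 1} :=
      measurable_subtype_coe (measurableSet_singleton 1)
    have hle : ∀ u, 0 < u → P {w | (w : ℝ) = 1} ≤ ENNReal.ofReal (f u) := fun u hu0 => by
      rw [← hu u hu0, ← lintegral_indicator_one hm]
      refine lintegral_mono (indicator_le fun w hw => ?_)
      have hw : (w : ℝ) = 1 := hw
      simp [hw]
    rw [withDensity_apply _ measurableSet_Ioi, Measure.restrict_restrict measurableSet_Ioi,
      inter_eq_left.2 (Ioi_subset_Ioi zero_le_one)]
    calc (⊤ : ℝ≥0∞) = ∫⁻ _ in Ioi (1 : ℝ), P {w | (w : ℝ) = 1} := by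
          rw [setLIntegral_const, Real.volume_Ioi, ENNReal.mul_top hne]
      _ ≤ _ := setLIntegral_mono' measurableSet_Ioi fun r hr =>
          hle _ (pow_pos (zero_lt_one.trans hr) p)
  filter_upwards [measure_eq_zero_iff_ae_notMem.1 h0, measure_eq_zero_iff_ae_notMem.1 h1]
    with w hw0 hw1
  exact ⟨lt_of_le_of_ne w.2.1 (Ne.symm hw0), lt_of_le_of_ne w.2.2 hw1⟩

theorem IsPolarDecomposition.ae_apply_Ioi_one_lt_top {d : ℕ}
    {ν : Measure (EuclideanSpace ℝ (Fin d))}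
    {σ : Measure (sphere (0 : EuclideanSpace ℝ (Fin d)) 1)}
    {κ : Kernel (sphere (0 : EuclideanSpace ℝ (Fin d)) 1) ℝ}
    (h : IsPolarDecomposition ν σ κ) (hν : IsLevyMeasure ν) : ∀ᵐ ξ ∂σ, κ ξ (Ioi 1) < ⊤ := by
  refine ae_lt_top (Kernel.measurable_coe κ measurableSet_Ioi) ?_
  have h1 := hν.measure_norm_gt_lt_top one_pos
  rw [h.apply_eq _ (measurableSet_lt measurable_const measurable_norm)] at h1
  refine (lt_of_le_of_lt (le_of_eq ?_) h1).ne
  refine lintegral_congr fun ξ => ?_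
  rw [← inter_eq_left.2 (Ioi_subset_Ioi zero_le_one : Ioi (1 : ℝ) ⊆ Ioi 0),
    ← Measure.restrict_apply measurableSet_Ioi, ← lintegral_indicator_one measurableSet_Ioi]
  refine setLIntegral_congr_fun measurableSet_Ioi fun r hr => ?_
  have hr0 : (0 : ℝ) < r := hr
  have hn : ‖r • (ξ : EuclideanSpace ℝ (Fin d))‖ = r := by
    rw [norm_smul, Real.norm_of_nonneg hr0.le, norm_eq_of_mem_sphere, mul_one]
  simp only [indicator, mem_Ioi, mem_ofPred_eq, hn, Pi.one_apply]

/-- A measurable choice of representing measures for the radial components. -/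
theorem IsPolarDecomposition.exists_measurable_representation {d : ℕ} {p : ℕ} (hp : 1 ≤ p)
    {ν : Measure (EuclideanSpace ℝ (Fin d))}
    {σ : Measure (sphere (0 : EuclideanSpace ℝ (Fin d)) 1)}
    {κ : Kernel (sphere (0 : EuclideanSpace ℝ (Fin d)) 1) ℝ}
    (h : IsPolarDecomposition ν σ κ) (hν : IsLevyMeasure ν)
    (hf : ∀ᵐ ξ ∂σ, ∃ f : ℝ → ℝ, IsCompletelyMonotone f ∧
      κ ξ = (volume.restrict (Ioi 0)).withDensity (fun r => ENNReal.ofReal (f (r ^ p)))) :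
    ∃ P : sphere (0 : EuclideanSpace ℝ (Fin d)) 1 → Measure (Icc (0 : ℝ) 1), Measurable P ∧
      (∀ ξ, IsFiniteMeasure (P ξ)) ∧ ∀ᵐ ξ ∂σ,
        (∀ᵐ w : Icc (0 : ℝ) 1 ∂(P ξ), 0 < (w : ℝ) ∧ (w : ℝ) < 1) ∧
        κ ξ = (volume.restrict (Ioi 0)).withDensity
          (fun r => ∫⁻ w, ENNReal.ofReal ((w : ℝ) ^ (r ^ p - 1)) ∂(P ξ)) := by
  classical
  have hgood := hf.and (h.ae_apply_Ioi_one_lt_top hν)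
  -- A measurable null set containing all exceptional directions; the family is set to `0` there.
  let N := toMeasurable σ {ξ | ¬ ((∃ f : ℝ → ℝ, IsCompletelyMonotone f ∧
      κ ξ = (volume.restrict (Ioi 0)).withDensity (fun r => ENNReal.ofReal (f (r ^ p)))) ∧
      κ ξ (Ioi 1) < ⊤)}
  have hN : MeasurableSet N := measurableSet_toMeasurable _ _
  have hN0 : ∀ᵐ ξ ∂σ, ξ ∉ N := by
    refine measure_eq_zero_iff_ae_notMem.1 ?_
    rw [measure_toMeasurable]
    exact hgood
  have hex : ∀ ξ, ξ ∉ N → ∃ f : ℝ → ℝ, IsCompletelyMonotone f ∧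
      κ ξ = (volume.restrict (Ioi 0)).withDensity (fun r => ENNReal.ofReal (f (r ^ p))) ∧
      ∃ P : Measure (Icc (0 : ℝ) 1), IsFiniteMeasure P ∧
        (∀ᵐ w : Icc (0 : ℝ) 1 ∂P, 0 < (w : ℝ) ∧ (w : ℝ) < 1) ∧
        (∀ k : ℕ, ∫ w, (w : ℝ) ^ k ∂P = f (1 + k)) ∧
        ∀ u, 0 < u → ∫⁻ w, ENNReal.ofReal ((w : ℝ) ^ (u - 1)) ∂P = ENNReal.ofReal (f u) := by
    intro ξ hξ
    have h1 := not_not.1 fun hn => hξ (subset_toMeasurable σ _ hn)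
    obtain ⟨⟨f, hfc, hκ⟩, hfin⟩ := h1
    exact ⟨f, hfc, hκ, hfc.exists_measure_of_withDensity_lt_top (hκ ▸ hfin)⟩
  choose! f hfc hκ P hPfin hPae hPmom hPu using hex
  have hPfin' : ∀ ξ, IsFiniteMeasure (if ξ ∈ N then 0 else P ξ) := fun ξ => by
    split_ifs with hξ
    · infer_instance
    · exact hPfin ξ hξ
  refine ⟨fun ξ => if ξ ∈ N then 0 else P ξ, measurable_of_moments fun k => ?_, hPfin', ?_⟩
  -- The `k`-th moment is `f(1 + k) = f(a ^ p)`, a limit of normalized masses of intervals to the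
  -- right of `a`.
  · let a : ℝ := (1 + k : ℝ) ^ (p⁻¹ : ℝ)
    have ha : 0 < a := by positivity
    have hap : a ^ p = 1 + k := Real.rpow_inv_natCast_pow (by positivity) (by omega)
    refine measurable_of_tendsto_metrizable (f := fun (n : ℕ) => N.piecewise (fun _ => 0)
      fun ξ => ((n : ℝ) + 1) * (κ ξ (Ioc a (a + 1 / ((n : ℝ) + 1)))).toReal) (fun n => ?_) ?_
    · exact measurable_const.piecewise hN
        ((Kernel.measurable_coe κ measurableSet_Ioc).ennreal_toReal.const_mul _)
    · refine tendsto_pi_nhds.2 fun ξ => ?_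
      by_cases hξ : ξ ∈ N
      · simp [hξ]
      · simp only [piecewise_eq_of_notMem _ _ _ hξ, if_neg hξ]
        rw [hPmom ξ hξ, ← hap, hκ ξ hξ]
        exact (hfc ξ hξ).tendsto_withDensity_Ioc p ha
  · filter_upwards [hN0] with ξ hξ
    simp only [if_neg hξ]
    refine ⟨hPae ξ hξ, (hκ ξ hξ).trans (withDensity_congr_ae ?_)⟩
    filter_upwards [ae_restrict_mem measurableSet_Ioi] with r hr
    rw [hPu ξ hξ _ (pow_pos (mem_Ioi.1 hr) p)]

/-- A Lévy measure whose radial components have densities `f_ξ(r ^ p)` with `f_ξ` completely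
monotone is a mixture of exponential rays. -/
theorem exists_eq_rayTransform_expKernel {d : ℕ} {p : ℕ} (hp : 1 ≤ p)
    {ν : Measure (EuclideanSpace ℝ (Fin d))} (hν : IsLevyMeasure ν)
    {σ : Measure (sphere (0 : EuclideanSpace ℝ (Fin d)) 1)}
    {κ : Kernel (sphere (0 : EuclideanSpace ℝ (Fin d)) 1) ℝ} (h : IsPolarDecomposition ν σ κ)
    (hf : ∀ᵐ ξ ∂σ, ∃ f : ℝ → ℝ, IsCompletelyMonotone f ∧
      κ ξ = (volume.restrict (Ioi 0)).withDensity (fun r => ENNReal.ofReal (f (r ^ p)))) :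
    ∃ η : Measure (EuclideanSpace ℝ (Fin d)), ν = rayTransform (expKernel p) η := by
  obtain ⟨P, hPm, hPfin, hP⟩ := h.exists_measurable_representation hp hν hf
  obtain ⟨Z, hZ⟩ := exists_measure_lintegral_prod σ hPm
  -- With `w = exp (-1 / s)`, that is `s = (-log w)⁻¹`, one has `w ^ (r ^ p - 1) = w⁻¹ exp (-r ^ p /
  -- s)`. This explains the weight `w⁻¹` below.
  let g : sphere (0 : EuclideanSpace ℝ (Fin d)) 1 × Icc (0 : ℝ) 1 → EuclideanSpace ℝ (Fin d) :=
    fun q => (-Real.log q.2)⁻¹ • (q.1 : EuclideanSpace ℝ (Fin d))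
  have hg : Measurable g := by
    refine Measurable.smul (Measurable.inv (Measurable.neg (Real.measurable_log.comp ?_)))
      (by fun_prop)
    exact measurable_subtype_coe.comp measurable_snd
  have hw : Measurable fun q : sphere (0 : EuclideanSpace ℝ (Fin d)) 1 × Icc (0 : ℝ) 1 =>
      ENNReal.ofReal (q.2 : ℝ)⁻¹ := by fun_prop
  refine ⟨(Z.withDensity fun q => ENNReal.ofReal (q.2 : ℝ)⁻¹).map g, Measure.ext fun B hB => ?_⟩
  have h0 : MeasurableSet ({0}ᶜ : Set (EuclideanSpace ℝ (Fin d))) :=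
    (measurableSet_singleton 0).compl
  have hBm : Measurable (B.indicator fun _ : EuclideanSpace ℝ (Fin d) => (1 : ℝ≥0∞)) :=
    measurable_const.indicator hB
  let H : EuclideanSpace ℝ (Fin d) → ℝ≥0∞ := ({0}ᶜ : Set (EuclideanSpace ℝ (Fin d))).indicator
    fun x => ∫⁻ r in Ioi (0 : ℝ), expKernel p r ‖x‖ * B.indicator (fun _ => (1 : ℝ≥0∞))
      (r • (‖x‖⁻¹ • x))
  have hH : Measurable H := (measurable_lintegral_ray (measurable_expKernel p) hBm).indicator h0
  have hHg : Measurable fun q => H (g q) := hH.comp hg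
  have hind : rayTransform (expKernel p) ((Z.withDensity fun q =>
      ENNReal.ofReal (q.2 : ℝ)⁻¹).map g) B = ∫⁻ y, B.indicator (fun _ => (1 : ℝ≥0∞)) y
        ∂(rayTransform (expKernel p) ((Z.withDensity fun q =>
          ENNReal.ofReal (q.2 : ℝ)⁻¹).map g)) := (lintegral_indicator_one hB).symm
  rw [h.apply_eq B hB, hind, lintegral_rayTransform (measurable_expKernel p) _ hBm,
    ← lintegral_indicator h0, lintegral_map hH hg, lintegral_withDensity_eq_lintegral_mul _ hw
      hHg, hZ _ (hw.mul hHg)]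
  refine lintegral_congr_ae ?_
  filter_upwards [hP] with ξ hξ
  obtain ⟨hae, hκ⟩ := hξ
  have hrm : Measurable fun r : ℝ => B.indicator (fun _ => (1 : ℝ≥0∞))
      (r • (ξ : EuclideanSpace ℝ (Fin d))) := hBm.comp (by fun_prop)
  have hwr : Measurable fun q : Icc (0 : ℝ) 1 × ℝ =>
      ENNReal.ofReal ((q.1 : ℝ) ^ (q.2 ^ p - 1)) := by fun_prop
  have hden : Measurable fun r : ℝ => ∫⁻ w, ENNReal.ofReal ((w : ℝ) ^ (r ^ p - 1)) ∂(P ξ) :=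
    hwr.lintegral_prod_left'
  have hstep : ∀ᵐ w ∂(P ξ), ((fun q : sphere (0 : EuclideanSpace ℝ (Fin d)) 1 × Icc (0 : ℝ) 1 =>
      ENNReal.ofReal (q.2 : ℝ)⁻¹) * fun q => H (g q)) (ξ, w)
      = ∫⁻ r in Ioi (0 : ℝ), ENNReal.ofReal ((w : ℝ) ^ (r ^ p - 1)) *
        B.indicator (fun _ => (1 : ℝ≥0∞)) (r • (ξ : EuclideanSpace ℝ (Fin d))) := by
    filter_upwards [hae] with w hw01
    have hs : 0 < (-Real.log w)⁻¹ := inv_pos.2 (neg_pos.2 (Real.log_neg hw01.1 hw01.2))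
    have hn : ‖g (ξ, w)‖ = (-Real.log w)⁻¹ := by
      rw [norm_smul, Real.norm_of_nonneg hs.le, norm_eq_of_mem_sphere, mul_one]
    have hne : g (ξ, w) ∈ ({0}ᶜ : Set (EuclideanSpace ℝ (Fin d))) := by
      refine norm_ne_zero_iff.1 ?_
      rw [hn]; exact hs.ne'
    have hdir : ‖g (ξ, w)‖⁻¹ • g (ξ, w) = (ξ : EuclideanSpace ℝ (Fin d)) := by
      rw [hn]; exact inv_smul_smul₀ hs.ne' _
    rw [Pi.mul_apply, show H (g (ξ, w)) = _ from indicator_of_mem hne _, hdir, hn,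
      ← lintegral_const_mul]
    · refine lintegral_congr fun r => ?_
      rw [← mul_assoc, expKernel, ← ENNReal.ofReal_mul (inv_nonneg.2 hw01.1.le), div_inv_eq_mul,
        Real.rpow_sub_one hw01.1.ne', Real.rpow_def_of_pos hw01.1, div_eq_inv_mul]
      congr 4
      ring
    · exact ((measurable_expKernel p).comp (by fun_prop : Measurable fun r : ℝ =>
        (r, (-Real.log w)⁻¹))).mul hrm
  have := hPfin ξ
  rw [lintegral_congr_ae hstep, lintegral_lintegral_swap, hκ,
    restrict_withDensity measurableSet_Ioi, Measure.restrict_restrict measurableSet_Ioi,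
    inter_self, lintegral_withDensity_eq_lintegral_mul _ hden hrm]
  · refine lintegral_congr fun r => ?_
    rw [lintegral_mul_const _ (by fun_prop)]
    rfl
  · exact (hwr.mul (hrm.comp measurable_snd)).aemeasurable

/-! ### The range of `𝒜₁ ∘ Υ⁰` -/

/-- On `(√s / 2, √s)` one has `min 1 r² ≥ min 1 s / 4` and `exp (-r² / s) ≥ e⁻¹`, and the interval
has length `√s / 2`. This turns the Lévy property of a type G measure into `∫ (1 ∧ |x|) dρ < ∞`. -/
theorem sqrt_mul_min_one_le_expWeight {s : ℝ} (hs : 0 < s) :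
    ENNReal.ofReal (√Real.pi / 2 * √s) * ENNReal.ofReal (min 1 s)
      ≤ ENNReal.ofReal (4 * √Real.pi * Real.exp 1) * expWeight 2 s := by
  have hs' : 0 < √s := Real.sqrt_pos.2 hs
  have hsq : √s ^ 2 = s := Real.sq_sqrt hs.le
  have hlow : ENNReal.ofReal (min 1 s / 4 * Real.exp (-1) * (√s / 2)) ≤ expWeight 2 s := by
    calc ENNReal.ofReal (min 1 s / 4 * Real.exp (-1) * (√s / 2))
        = ∫⁻ _ in Ioo (√s / 2) √s, ENNReal.ofReal (min 1 s / 4 * Real.exp (-1)) := by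
          rw [setLIntegral_const, Real.volume_Ioo, sub_half, ENNReal.ofReal_mul (by positivity)]
      _ ≤ ∫⁻ r in Ioo (√s / 2) √s, ENNReal.ofReal (min 1 (r ^ 2)) * expKernel 2 r s := by
          refine setLIntegral_mono' measurableSet_Ioo fun r hr => ?_
          have hr0 : 0 < r := lt_trans (by positivity) hr.1
          rw [expKernel, ← ENNReal.ofReal_mul (by positivity)]
          refine ENNReal.ofReal_le_ofReal (mul_le_mul ?_ (Real.exp_le_exp.2 ?_) (by positivity)
            (by positivity))
          · refine le_min ?_ ?_
            · linarith [min_le_left 1 s]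
            · have := pow_le_pow_left₀ (by positivity) hr.1.le 2
              rw [div_pow, hsq] at this
              linarith [min_le_right 1 s]
          · rw [neg_le_neg_iff, div_le_one hs, ← hsq]
            exact pow_le_pow_left₀ hr0.le hr.2.le 2
      _ ≤ expWeight 2 s := lintegral_mono_set fun r hr => lt_trans (by positivity) hr.1
  refine le_trans (le_of_eq ?_) (mul_le_mul_right hlow _)
  rw [← ENNReal.ofReal_mul (by positivity), ← ENNReal.ofReal_mul (by positivity)]
  congr 1
  have : Real.exp 1 * Real.exp (-1) = 1 := by rw [← Real.exp_add]; simp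
  linear_combination (-(√Real.pi / 2 * √s * min 1 s)) * this

theorem upsilonZero_eq_rayTransform_expKernel {d : ℕ} {ρ : Measure (EuclideanSpace ℝ (Fin d))}
    (h : IsLevyMeasure ρ) : upsilonZero ρ
      = rayTransform (expKernel 1) (ρ.withDensity fun x => ENNReal.ofReal ‖x‖⁻¹) := by
  have := h.sigmaFinite
  rw [upsilonZero_eq_rayTransform ρ h.zero, rayTransform_withDensity (measurable_expKernel 1)
    (c := fun s => ENNReal.ofReal s⁻¹) (by fun_prop)]

/-- The weight `(√π / 2) √|x|` defining `ρ` cancels the factors `|x|⁻¹` from `Υ⁰` and `(2 / √π)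
√|x|` from `𝒜₁`. -/
theorem exists_eq_arcsine_upsilonZero {d : ℕ} {η : Measure (EuclideanSpace ℝ (Fin d))}
    (hν : IsLevyMeasure (rayTransform (expKernel 2) η)) :
    ∃ ρ, IsLevyMeasureOne ρ ∧ rayTransform (expKernel 2) η = arcsine (upsilonZero ρ) := by
  have h0 := measurableSet_singleton (0 : EuclideanSpace ℝ (Fin d))
  have hc : Measurable fun x : EuclideanSpace ℝ (Fin d) =>
    ENNReal.ofReal (√Real.pi / 2 * √‖x‖) := by fun_prop
  let ρ := (η.restrict {0}ᶜ).withDensity fun x => ENNReal.ofReal (√Real.pi / 2 * √‖x‖)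
  have hρ : IsLevyMeasureOne ρ := by
    refine isLevyMeasureOne_of_lintegral (withDensity_absolutelyContinuous _ _ ?_) ?_
    · rw [Measure.restrict_apply h0, inter_compl_self, measure_empty]
    · rw [lintegral_withDensity_eq_lintegral_mul _ hc (by fun_prop)]
      refine lt_of_le_of_lt (setLIntegral_mono' h0.compl fun x hx =>
        sqrt_mul_min_one_le_expWeight (norm_pos_iff.2 hx)) ?_
      have hm : Measurable fun x : EuclideanSpace ℝ (Fin d) => expWeight 2 ‖x‖ :=
        (measurable_expWeight 2).comp measurable_norm
      rw [lintegral_const_mul _ hm]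
      exact ENNReal.mul_lt_top ENNReal.ofReal_lt_top hν.lintegral_expWeight_lt_top
  refine ⟨ρ, hρ, ?_⟩
  rw [upsilonZero_eq_rayTransform_expKernel hρ.isLevyMeasure, arcsine_rayTransform_expKernel]
  refine Measure.ext_of_lintegral _ fun F hF => ?_
  rw [lintegral_rayTransform (measurable_expKernel 2) _ hF,
    lintegral_rayTransform (measurable_expKernel 2) _ hF]
  congr 1
  rw [restrict_withDensity h0.compl, restrict_withDensity h0.compl, restrict_withDensity h0.compl,
    Measure.restrict_restrict h0.compl, inter_self, ← withDensity_mul _ hc (by fun_prop),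
    ← withDensity_mul _ (hc.mul (by fun_prop)) (by fun_prop)]
  nth_rewrite 1 [← withDensity_one (μ := η.restrict {0}ᶜ)]
  refine withDensity_congr_ae ?_
  filter_upwards [ae_restrict_mem h0.compl] with x hx
  have hx0 : 0 < ‖x‖ := norm_pos_iff.2 hx
  have hpi : 0 < √Real.pi := Real.sqrt_pos.2 Real.pi_pos
  have hs : √‖x‖ * √‖x‖ = ‖x‖ := Real.mul_self_sqrt hx0.le
  simp only [Pi.mul_apply, Pi.one_apply]
  rw [← ENNReal.ofReal_mul (by positivity), ← ENNReal.ofReal_mul (by positivity),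
    ← ENNReal.ofReal_one]
  congr 1
  field_simp
  rw [sq, hs]

theorem IsLevyMeasureOne.isLevyMeasureB_upsilonZero {d : ℕ}
    {ρ : Measure (EuclideanSpace ℝ (Fin d))} (h : IsLevyMeasureOne ρ) :
    IsLevyMeasureB (ArcsineTransform.upsilonZero ρ) := by
  have hL := h.upsilonZero.isLevyMeasure
  refine ⟨hL, ?_⟩
  rw [upsilonZero_eq_rayTransform_expKernel h.isLevyMeasure] at hL ⊢
  simpa only [pow_one] using exists_polarDecomposition_rayTransform le_rfl _ hL

theorem IsLevyMeasureB.isLevyMeasureG_arcsine {d : ℕ} {ν : Measure (EuclideanSpace ℝ (Fin d))}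
    (h : IsLevyMeasureB ν) (hL : IsLevyMeasure (arcsine ν)) : IsLevyMeasureG (arcsine ν) := by
  obtain ⟨hν, σ, κ, hpol, hf⟩ := h
  obtain ⟨η, rfl⟩ := exists_eq_rayTransform_expKernel le_rfl hν hpol
    (by simpa only [pow_one] using hf)
  refine ⟨hL, ?_⟩
  rw [arcsine_rayTransform_expKernel] at hL ⊢
  exact exists_polarDecomposition_rayTransform one_le_two _ hL

theorem IsLevyMeasureG.exists_eq_arcsine_upsilonZero {d : ℕ}
    {ν : Measure (EuclideanSpace ℝ (Fin d))} (h : IsLevyMeasureG ν) :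
    ∃ ρ, IsLevyMeasureOne ρ ∧ ν = arcsine (upsilonZero ρ) := by
  obtain ⟨hν, σ, κ, hpol, hf⟩ := h
  obtain ⟨η, rfl⟩ := exists_eq_rayTransform_expKernel one_le_two hν hpol hf
  exact ArcsineTransform.exists_eq_arcsine_upsilonZero hν

end ArcsineTransform

end

/-! ### Equivalence of the three conditions, and uniqueness of `ν` and `ρ` -/

theorem mainTheorem3 (d : ℕ) (μ : MeasureTheory.Measure (EuclideanSpace ℝ (Fin d)))
    (hμ : ArcsineTransform.IsInfinitelyDivisible μ)
    (S : Matrix (Fin d) (Fin d) ℝ) (ν' : MeasureTheory.Measure (EuclideanSpace ℝ (Fin d)))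
    (γ : EuclideanSpace ℝ (Fin d))
    (hT : ArcsineTransform.HasLevyKhintchineTriplet μ S ν' γ) :
    [ μ ∈ ArcsineTransform.classG d,
      ∃ ν : MeasureTheory.Measure (EuclideanSpace ℝ (Fin d)),
        ArcsineTransform.IsLevyMeasureB ν ∧ ArcsineTransform.IsLevyMeasureOne ν ∧
          ν' = ArcsineTransform.arcsine ν,
      ∃ ρ : MeasureTheory.Measure (EuclideanSpace ℝ (Fin d)),
        ArcsineTransform.IsLevyMeasureOne ρ ∧
          ν' = ArcsineTransform.arcsine (ArcsineTransform.upsilonZero ρ) ].TFAE ∧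
    (∀ ν₁ ν₂ : MeasureTheory.Measure (EuclideanSpace ℝ (Fin d)),
      ArcsineTransform.IsLevyMeasureB ν₁ → ArcsineTransform.IsLevyMeasureOne ν₁ →
      ArcsineTransform.IsLevyMeasureB ν₂ → ArcsineTransform.IsLevyMeasureOne ν₂ →
      ν' = ArcsineTransform.arcsine ν₁ → ν' = ArcsineTransform.arcsine ν₂ → ν₁ = ν₂) ∧
    (∀ ρ₁ ρ₂ : MeasureTheory.Measure (EuclideanSpace ℝ (Fin d)),
      ArcsineTransform.IsLevyMeasureOne ρ₁ → ArcsineTransform.IsLevyMeasureOne ρ₂ →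
      ν' = ArcsineTransform.arcsine (ArcsineTransform.upsilonZero ρ₁) →
      ν' = ArcsineTransform.arcsine (ArcsineTransform.upsilonZero ρ₂) → ρ₁ = ρ₂) := by
  refine ⟨?_, fun ν₁ ν₂ hB₁ _ hB₂ _ h₁ h₂ =>
      ArcsineTransform.arcsine_injective hB₁.1 hB₂.1 (h₁.symm.trans h₂),
    fun ρ₁ ρ₂ hρ₁ hρ₂ h₁ h₂ => ArcsineTransform.upsilonZero_injective hρ₁ hρ₂
      (ArcsineTransform.arcsine_injective hρ₁.upsilonZero.isLevyMeasure
        hρ₂.upsilonZero.isLevyMeasure (h₁.symm.trans h₂))⟩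
  tfae_have 1 → 3 := by
    rintro ⟨-, S₂, ν₂, γ₂, hT₂, hG⟩
    -- Membership in the class supplies some triplet; its Lévy measure must be the given one.
    obtain rfl := hT.levyMeasure_unique hT₂
    exact hG.exists_eq_arcsine_upsilonZero
  tfae_have 3 → 2 := by
    rintro ⟨ρ, hρ, h⟩
    exact ⟨_, hρ.isLevyMeasureB_upsilonZero, hρ.upsilonZero, h⟩
  tfae_have 2 → 1 := by
    rintro ⟨ν, hB, -, rfl⟩
    -- That `𝒜₁(ν)` is a Lévy measure is part of the given triplet.
    exact ⟨hμ, S, _, γ, hT, hB.isLevyMeasureG_arcsine hT.isLevyMeasure⟩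
  tfae_finish
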